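/- Let $K$ be an algebraically closed field of characteristic zero and $S=K[x_1,\dots,x_n]$. For a quadratic form $Q\in S$ let $\operatorname{rank}(Q)$ be the least $s$ such that $Q=\sum_{i=1}^s a_ib_i$ with linear forms $a_i,b_i$. If $\operatorname{rank}(Q)\ge 5$, put $\operatorname{Lin}(Q)=\operatorname{span}_K(Q)$; otherwise let $\operatorname{Lin}(Q)=\operatorname{span}_K(a_1,\dots,a_s,b_1,\dots,b_s)$ for such a representation with $s=\operatorname{rank}(Q)$ (this space does not depend on the choice of the representation). Let $Q_1,Q_2\in S$ be irreducible quadratic forms with $\operatorname{Lin}(Q_1)\neq\operatorname{Lin}(Q_2)$. Suppose that the ideal $(Q_1,Q_2)$ is not radical and that $\operatorname{span}_K(Q_1,Q_2)$ does not contain the square of any nonzero linear form. Then there exist linearly independent linear forms $x,y$ such that: 1. $(x,y)$ is a minimal prime of $(Q_1,Q_2)$, and $(x,y^2)$ is the $(x,y)$-primary component of $(Q_1,Q_2)$; 2. there exist linear forms $a,b$ such that $a,b,x,y$ are linearly independent and, up to multiplying $Q_1$ and $Q_2$ by nonzero scalars, $Q_1=ax+y^2$ and $Q_2=bx+y^2$;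 that is, $Q_1=c_1(ax+y^2)$ and $Q_2=c_2(bx+y^2)$ for some $c_1,c_2\in K\setminus\{0\}$. -/

import Mathlib

noncomputable section

namespace QuadraticForms

open MvPolynomial

variable {K : Type*} [Field K] {n : ℕ}

/-- `Q = a₁ b₁ + ⋯ + aₛ bₛ` with all `aᵢ`, `bᵢ` linear forms. -/
def IsRepresentation (Q : MvPolynomial (Fin n) K) (s : ℕ)
    (a b : Fin s → MvPolynomial (Fin n) K) : Prop :=
  (∀ i, (a i).IsHomogeneous 1) ∧ (∀ i, (b i).IsHomogeneous 1) ∧ Q = ∑ i, a i * b i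

/-- The rank of a quadratic form: the least number of products of two linear forms
that sum to it. Every form of degree 2 has some representation, so the infimum is attained. -/
def rank (Q : MvPolynomial (Fin n) K) : ℕ :=
  sInf {s : ℕ | ∃ a b : Fin s → MvPolynomial (Fin n) K, IsRepresentation Q s a b}

/-- The linear span of the linear forms that occur in a minimal representation of `Q`.
In characteristic not 2 this span does not depend on the minimal representation,
so collecting the linear forms from all minimal representations gives that same space. -/
def linSpan (Q : MvPolynomial (Fin n) K) : Submodule K (MvPolynomial (Fin n) K) :=
  Submodule.span K {l | ∃ a b : Fin (rank Q) → MvPolynomial (Fin n) K,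
    IsRepresentation Q (rank Q) a b ∧ ∃ i, l = a i ∨ l = b i}

/-- `Lin(Q)`: the line spanned by `Q` if `Q` has rank at least 5, and the span of the linear
forms in a minimal representation of `Q` otherwise. -/
def Lin (Q : MvPolynomial (Fin n) K) : Submodule K (MvPolynomial (Fin n) K) :=
  if 5 ≤ rank Q then Submodule.span K {Q} else linSpan Q

/-- `q` is the `p`-primary component of `I`, for a minimal prime `p` of `I`: it occurs in an
irredundant primary decomposition of `I` and has radical `p`. (For a minimal prime `p`
the component is the same in all irredundant primary decompositions.) -/
def IsPrimaryComponent {R : Type*} [CommRing R] (I p q : Ideal R) : Prop :=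
  p ∈ I.minimalPrimes ∧
    ∃ t : Finset (Ideal R), Submodule.IsMinimalPrimaryDecomposition I t ∧ q ∈ t ∧ q.radical = p

end QuadraticForms

end

/-! Linear coordinates turn Q₁ into z² - D up to a scalar, and subtracting a multiple of it turns Q₂
into l z + q, where D, l, q do not involve z. Over the polynomial ring R in the remaining variables,
R[z]/(z² - D) is free on 1 and z, so radicality of the ideal becomes a question of divisibility in
the factorial ring R (`isRadical_span_of_forall`). The main invariant is the norm q² - D l² of l z +
q: if l ≠ 0 does not divide q, a squarefree norm makes the ideal radical. The cases l = 0 and l ∣ q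
have similar criteria.

A nonradical ideal therefore yields a repeated or common factor, and unwinding it
(`configuration_of_normalForm`) leaves three outcomes: a square of a linear form in the pencil,
excluded by hypothesis; a binary member (`HasBinaryMember`); or Q₁ = a x + α y², Q₂ = b x + β y²
(`AreTangent`). A binary form splits over K, so by irreducibility both Q₁ and Q₂ occur in a binary
member; solving for either one shows that their linear forms span the same space, against the
hypothesis on Lin (`lin_eq_lin_of_binary_member`).

In the tangent case α, β ≠ 0 by irreducibility, and rescaling gives the required shape. A linear
relation involving a or b would produce a binary member, so a, b, x, y are independent. Finally x (a
- b) lies in the ideal and a - b is outside (x, y), so every (x, y)-primary ideal above it contains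
x, hence y². -/

namespace QuadricPencil

/-! ### Radical ideals in a quadratic extension R[X]/(X² - D) -/

section QuadraticExtension

open Polynomial

variable {R : Type*} [CommRing R]

/-- Membership of a linear polynomial in the ideal `(X² - D, m X + q)` of `R[X]`, in terms of
coefficients. -/
theorem exists_of_linear_mem_span {D m q u v : R}
    (h : C u + C v * X ∈ Ideal.span {X ^ 2 - C D, C m * X + C q}) :
    ∃ s t, u = q * s + m * D * t ∧ v = m * s + q * t := by
  obtain ⟨A, B, hAB⟩ := Ideal.mem_span_pair.1 h
  -- Evaluation at ω, where ω² = D, kills the first generator; the two coordinates of the result are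
  -- compared.
  let ω : QuadraticAlgebra R D 0 := ⟨0, 1⟩
  have hω : ω ^ 2 = algebraMap R _ D := by
    ext <;> simp [ω, pow_two]
  have key := congrArg (aeval ω) hAB
  simp only [map_add, map_mul, map_sub, map_pow, aeval_X, aeval_C, hω, sub_self, mul_zero,
    zero_add] at key
  refine ⟨(aeval ω B).re, (aeval ω B).im, ?_, ?_⟩
  · have := congrArg QuadraticAlgebra.re key
    simp [ω] at this
    linear_combination -this
  · have := congrArg QuadraticAlgebra.im key
    simp [ω] at this
    linear_combination -this

theorem linear_mem_span {D m q u v s t : R} (hu : u = q * s + m * D * t)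
    (hv : v = m * s + q * t) :
    C u + C v * X ∈ Ideal.span {X ^ 2 - C D, C m * X + C q} := by
  refine Ideal.mem_span_pair.2 ⟨-C (m * t), C s + C t * X, ?_⟩
  subst hu hv
  simp only [map_add, map_mul]
  ring

theorem exists_linear_sub_mem_span (D : R) (f : R[X]) :
    ∃ u v : R, f - (C u + C v * X) ∈ Ideal.span {X ^ 2 - C D} := by
  induction f using Polynomial.induction_on' with
  | add p q hp hq =>
    obtain ⟨u, v, h⟩ := hp
    obtain ⟨u', v', h'⟩ := hq
    refine ⟨u + u', v + v', ?_⟩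
    convert! Ideal.add_mem _ h h' using 1
    simp only [map_add]; ring
  | monomial n a =>
    induction n with
    | zero => exact ⟨a, 0, by simp⟩
    | succ n ih =>
      obtain ⟨u, v, h⟩ := ih
      refine ⟨v * D, u, ?_⟩
      have h1 := Ideal.mul_mem_right X _ h
      have h2 : C v * (X ^ 2 - C D) ∈ Ideal.span {X ^ 2 - C D} :=
        Ideal.mul_mem_left _ _ (Ideal.mem_span_singleton_self _)
      convert! Ideal.add_mem _ h1 h2 using 1
      rw [← monomial_mul_X]
      simp only [map_mul]; ring

/-- A criterion for the ideal `(X² - D, m X + q)` of `R[X]` to be radical. -/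
theorem isRadical_span_of_forall {D m q : R}
    (h : ∀ u v s t : R, u ^ 2 + v ^ 2 * D = q * s + m * D * t → 2 * u * v = m * s + q * t →
      ∃ s' t', u = q * s' + m * D * t' ∧ v = m * s' + q * t') :
    (Ideal.span {X ^ 2 - C D, C m * X + C q}).IsRadical := by
  rw [Ideal.isRadical_iff_pow_one_lt 2 one_lt_two]
  intro f hf
  have hle : Ideal.span {X ^ 2 - C D} ≤ Ideal.span {X ^ 2 - C D, C m * X + C q} :=
    Ideal.span_mono (by simp)
  -- Modulo X² - D, f is u + v X and f² is (u² + v² D) + 2 u v X.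
  obtain ⟨u, v, huv⟩ := exists_linear_sub_mem_span D f
  replace huv := hle huv
  have hmem : C (u ^ 2 + v ^ 2 * D) + C (2 * u * v) * X ∈
      Ideal.span {X ^ 2 - C D, C m * X + C q} := by
    have h1 := Ideal.mul_mem_left _ (f + (C u + C v * X)) huv
    have h2 : C (v ^ 2) * (X ^ 2 - C D) ∈ Ideal.span {X ^ 2 - C D, C m * X + C q} :=
      Ideal.mul_mem_left _ _ (Ideal.subset_span (by simp))
    convert! Ideal.sub_mem _ (Ideal.sub_mem _ hf h1) h2 using 1
    simp only [map_add, map_mul, map_pow, map_ofNat]; ring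
  obtain ⟨s, t, h1, h2⟩ := exists_of_linear_mem_span hmem
  obtain ⟨s', t', h3, h4⟩ := h u v s t h1 h2
  have := Ideal.add_mem _ huv (linear_mem_span h3 h4)
  simpa using this

variable [UniqueFactorizationMonoid R]

/-- If (u + v X)² lies in the ideal, q divides 2uv and u² + v² D. Hence q ∣ u³, so q ∣ u; then q ∣
v² D, so q ∣ v. -/
theorem isRadical_span_of_squarefree_of_isRelPrime {D q : R} (h2 : IsUnit (2 : R))
    (hq : Squarefree q) (hqD : IsRelPrime q D) :
    (Ideal.span {X ^ 2 - C D, C q}).IsRadical := by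
  have key : (Ideal.span {X ^ 2 - C D, C 0 * X + C q}).IsRadical := by
    refine isRadical_span_of_forall fun u v s t h h' ↦ ?_
    have huv : q ∣ u * v := by
      rw [← h2.dvd_mul_left]
      exact ⟨t, by linear_combination h'⟩
    have hu : q ∣ u := by
      refine (hq.dvd_pow_iff_dvd three_ne_zero).1 ?_
      obtain ⟨w, hw⟩ := huv
      exact ⟨s * u - w * v * D, by linear_combination u * h - v * D * hw⟩
    have hv : q ∣ v := by
      refine (hq.dvd_pow_iff_dvd two_ne_zero).1 ?_
      refine hqD.dvd_of_dvd_mul_right ?_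
      obtain ⟨w, rfl⟩ := hu
      exact ⟨s - w ^ 2 * q, by linear_combination h⟩
    obtain ⟨s', rfl⟩ := hu
    obtain ⟨t', rfl⟩ := hv
    exact ⟨s', t', by ring, by ring⟩
  simpa using key

/-- Multiply u + v X by the conjugate q - m X: the X-coordinate is q v - m u. When (u + v X)² lies
in the ideal, the norm divides the square of this coordinate, hence the coordinate itself. The
quotient t' is the X-coefficient of the cofactor; the other coefficient is found by dividing by m,
which is prime to the norm because m ∤ q. -/
theorem isRadical_span_of_squarefree_norm [IsDomain R] {D m q : R} (hm : Prime m) (hmq : ¬ m ∣ q)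
    (hr : Squarefree (q ^ 2 - D * m ^ 2)) :
    (Ideal.span {X ^ 2 - C D, C m * X + C q}).IsRadical := by
  refine isRadical_span_of_forall fun u v s t h h' ↦ ?_
  obtain ⟨t', ht'⟩ : q ^ 2 - D * m ^ 2 ∣ q * v - m * u := by
    refine (hr.dvd_pow_iff_dvd two_ne_zero).1 ⟨v ^ 2 - m * t, ?_⟩
    linear_combination m ^ 2 * h - m * q * h'
  have hdvd : m ∣ v - q * t' := by
    have : m ∣ (q ^ 2 - D * m ^ 2) * (v - q * t') :=
      ⟨q * u - m * D * v, by linear_combination q * ht'⟩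
    refine (hm.dvd_or_dvd this).resolve_left fun hd ↦ hmq (hm.dvd_of_dvd_pow (n := 2) ?_)
    exact (dvd_sub_left ⟨D * m, by ring⟩).1 hd
  obtain ⟨s', hs'⟩ := hdvd
  refine ⟨s', t', mul_left_cancel₀ hm.ne_zero ?_, by linear_combination hs'⟩
  linear_combination -ht' + q * hs'

/-- The second generator is m (X + e). The factor m divides u and v because m ∤ D. Modulo X + e the
ring becomes R/(e² - D), which is reduced, so e² - D divides u - e v; as m is prime to e² - D, both
conditions hold at once. -/
theorem isRadical_span_of_squarefree_of_not_dvd {D m e : R} (h2 : IsUnit (2 : R)) (hm : Prime m)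
    (hmD : ¬ m ∣ D) (hmE : ¬ m ∣ e ^ 2 - D) (hE : Squarefree (e ^ 2 - D)) :
    (Ideal.span {X ^ 2 - C D, C m * X + C (m * e)}).IsRadical := by
  refine isRadical_span_of_forall fun u v s t h h' ↦ ?_
  have huv : m ∣ u * v := by
    rw [← h2.dvd_mul_left]
    exact ⟨s + e * t, by linear_combination h'⟩
  have hsum : m ∣ u ^ 2 + v ^ 2 * D := ⟨e * s + D * t, by linear_combination h⟩
  have hboth : m ∣ u ∧ m ∣ v := by
    rcases hm.dvd_or_dvd huv with hu | hv
    · have : m ∣ v ^ 2 * D := (dvd_add_right (hu.trans (dvd_pow_self u two_ne_zero))).1 hsum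
      exact ⟨hu, hm.dvd_of_dvd_pow ((hm.dvd_or_dvd this).resolve_right hmD)⟩
    · have : m ∣ u ^ 2 :=
        (dvd_add_left ((hv.trans (dvd_pow_self v two_ne_zero)).mul_right D)).1 hsum
      exact ⟨hm.dvd_of_dvd_pow this, hv⟩
  obtain ⟨⟨u, rfl⟩, ⟨v, rfl⟩⟩ := hboth
  have hEuv : e ^ 2 - D ∣ m * (u - e * v) := by
    refine (hE.dvd_pow_iff_dvd two_ne_zero).1 ⟨(m * v) ^ 2 - m * t, ?_⟩
    linear_combination h - e * h'
  have hrel : IsRelPrime (e ^ 2 - D) m :=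
    ((hm.irreducible.isRelPrime_iff_not_dvd).2 hmE).symm
  obtain ⟨w, hw⟩ := hrel.dvd_of_dvd_mul_left hEuv
  exact ⟨e * w + v, -w, by linear_combination m * hw, by ring⟩

end QuadraticExtension

open MvPolynomial

/-! ### Homogeneous factors, quotients and ideal coefficients -/

section Homogeneous

variable {σ R : Type*} [CommRing R]

/-- The substitution X i ↦ X i · T records degree as the exponent of T, so statements about
homogeneity become statements about univariate polynomials. -/
theorem aeval_C_X_mul_X_of_isHomogeneous {f : MvPolynomial σ R} {k : ℕ} (hf : f.IsHomogeneous k) :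
    aeval (fun i ↦ (Polynomial.C (X i) * Polynomial.X : Polynomial (MvPolynomial σ R))) f =
      Polynomial.C f * Polynomial.X ^ k := by
  rw [aeval_def, eval₂_eq]
  conv_rhs => rw [f.as_sum]
  rw [map_sum, Finset.sum_mul]
  refine Finset.sum_congr rfl fun d hd ↦ ?_
  have hk : ∑ i ∈ d.support, d i = k := (hf.degree_eq_sum_deg_support hd).symm
  simp_rw [mul_pow]
  rw [Finset.prod_mul_distrib, Finset.prod_pow_eq_pow_sum, hk, monomial_eq, Finsupp.prod]
  simp only [map_mul, map_prod, map_pow, mul_assoc]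
  rfl

theorem coeff_aeval_C_X_mul_X (f : MvPolynomial σ R) (k : ℕ) :
    (aeval (fun i ↦ (Polynomial.C (X i) * Polynomial.X : Polynomial (MvPolynomial σ R))) f).coeff k
      = homogeneousComponent k f := by
  conv_lhs => rw [← sum_homogeneousComponent f]
  rw [map_sum, Polynomial.finsetSum_coeff]
  simp_rw [aeval_C_X_mul_X_of_isHomogeneous (homogeneousComponent_isHomogeneous _ f),
    Polynomial.coeff_C_mul_X_pow]
  rw [Finset.sum_ite_eq]
  split_ifs with h
  · rfl
  · rw [homogeneousComponent_eq_zero]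
    simpa [Nat.lt_succ_iff] using h

/-- The factors of a nonzero homogeneous polynomial are homogeneous. -/
theorem isHomogeneous_of_mul [IsDomain R] {a b : MvPolynomial σ R} {d : ℕ}
    (h : (a * b).IsHomogeneous d) (h0 : a * b ≠ 0) :
    ∃ i j, i + j = d ∧ a.IsHomogeneous i ∧ b.IsHomogeneous j := by
  set φ := aeval (R := R)
    (fun i ↦ (Polynomial.C (X i) * Polynomial.X : Polynomial (MvPolynomial σ R))) with hφ
  have hab : φ a * φ b = Polynomial.C (a * b) * Polynomial.X ^ d := by
    rw [← map_mul, hφ, aeval_C_X_mul_X_of_isHomogeneous h]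
  have hne : φ a * φ b ≠ 0 := by rw [hab]; simpa using h0
  have ha := left_ne_zero_of_mul hne
  have hb := right_ne_zero_of_mul hne
  -- Degree and trailing degree in T are both additive and both equal d on the product, so they
  -- agree on each factor.
  have hdeg : (φ a).natDegree + (φ b).natDegree = d := by
    rw [← Polynomial.natDegree_mul ha hb, hab, Polynomial.natDegree_C_mul_X_pow _ _ h0]
  have htr : (φ a).natTrailingDegree + (φ b).natTrailingDegree = d := by
    rw [← Polynomial.natTrailingDegree_mul ha hb, hab,
      Polynomial.C_mul_X_pow_eq_monomial, Polynomial.natTrailingDegree_monomial h0]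
  have hla := (φ a).natTrailingDegree_le_natDegree
  have hlb := (φ b).natTrailingDegree_le_natDegree
  have key : ∀ f : MvPolynomial σ R, (φ f).natTrailingDegree = (φ f).natDegree →
      f.IsHomogeneous (φ f).natDegree := by
    intro f hf
    have : f = homogeneousComponent (φ f).natDegree f := by
      conv_lhs => rw [← sum_homogeneousComponent f]
      refine Finset.sum_eq_single _ (fun k _ hk ↦ ?_) fun hk ↦ ?_
      · rw [← coeff_aeval_C_X_mul_X]
        rcases lt_or_gt_of_ne hk with h | h
        · exact Polynomial.coeff_eq_zero_of_lt_natTrailingDegree (hf ▸ h)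
        · exact Polynomial.coeff_eq_zero_of_natDegree_lt h
      · rw [homogeneousComponent_eq_zero]
        simpa [Nat.lt_succ_iff] using hk
    rw [this]
    convert! homogeneousComponent_isHomogeneous _ f using 2
    rw [← this]
  exact ⟨_, _, hdeg, key a (by omega), key b (by omega)⟩

/-- This lets cofactors be replaced by their components of the expected degree. -/
theorem homogeneousComponent_mul_of_isHomogeneous {a : MvPolynomial σ R} {i : ℕ}
    (ha : a.IsHomogeneous i) (j : ℕ) (b : MvPolynomial σ R) :
    homogeneousComponent (i + j) (a * b) = a * homogeneousComponent j b := by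
  simp_rw [← coeff_aeval_C_X_mul_X, map_mul, aeval_C_X_mul_X_of_isHomogeneous ha]
  rw [mul_assoc, Polynomial.coeff_C_mul, add_comm i j, mul_comm (_ ^ i), Polynomial.coeff_mul_X_pow]

theorem exists_isHomogeneous_of_dvd {a h : MvPolynomial σ R} {i : ℕ} (j : ℕ)
    (ha : a.IsHomogeneous i) (hh : h.IsHomogeneous (i + j)) (hd : a ∣ h) :
    ∃ g, g.IsHomogeneous j ∧ h = a * g := by
  obtain ⟨b, rfl⟩ := hd
  refine ⟨_, homogeneousComponent_isHomogeneous j b, ?_⟩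
  rw [← homogeneousComponent_mul_of_isHomogeneous ha, homogeneousComponent_eq_self hh]

theorem exists_isHomogeneous_of_mem_span_pair {a b h : MvPolynomial σ R} {i : ℕ} (j : ℕ)
    (ha : a.IsHomogeneous i) (hb : b.IsHomogeneous i) (hh : h.IsHomogeneous (i + j))
    (hm : h ∈ Ideal.span {a, b}) :
    ∃ g k, g.IsHomogeneous j ∧ k.IsHomogeneous j ∧ h = a * g + b * k := by
  obtain ⟨g, k, hgk⟩ := Ideal.mem_span_pair.1 hm
  refine ⟨_, _, homogeneousComponent_isHomogeneous j g, homogeneousComponent_isHomogeneous j k, ?_⟩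
  rw [← homogeneousComponent_mul_of_isHomogeneous ha, ← homogeneousComponent_mul_of_isHomogeneous hb,
    ← map_add, mul_comm a, mul_comm b, hgk, homogeneousComponent_eq_self hh]

theorem exists_eq_C_of_isHomogeneous_zero {f : MvPolynomial σ R} (hf : f.IsHomogeneous 0) :
    ∃ c, f = C c :=
  ⟨_, by rw [← homogeneousComponent_zero, homogeneousComponent_eq_self hf]⟩

theorem not_isUnit_of_isHomogeneous [IsDomain R] {f : MvPolynomial σ R} {d : ℕ}
    (hf : f.IsHomogeneous d) (hd : d ≠ 0) : ¬ IsUnit f := by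
  intro h
  obtain ⟨g, hg⟩ := h.exists_right_inv
  have h1 : (f * g).IsHomogeneous 0 := by rw [hg]; exact isHomogeneous_one _ _
  obtain ⟨i, j, hij, hi, -⟩ := isHomogeneous_of_mul h1 (by simp [hg])
  have := hf.inj_right hi h.ne_zero
  omega

theorem not_irreducible_mul [IsDomain R] {f g : MvPolynomial σ R} {i j : ℕ}
    (hf : f.IsHomogeneous i) (hg : g.IsHomogeneous j) (hi : i ≠ 0) (hj : j ≠ 0) :
    ¬ Irreducible (f * g) := fun h ↦
  (h.isUnit_or_isUnit rfl).elim (not_isUnit_of_isHomogeneous hf hi)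
    (not_isUnit_of_isHomogeneous hg hj)

theorem exists_sq_mul_of_not_squarefree {K : Type*} [Field K] {r : MvPolynomial σ K} {d : ℕ}
    (hr : r.IsHomogeneous d) (hr0 : r ≠ 0) (hsq : ¬ Squarefree r) :
    ∃ k j p s, 1 ≤ k ∧ 2 * k + j = d ∧ p.IsHomogeneous k ∧ s.IsHomogeneous j ∧ p ≠ 0 ∧
      r = p ^ 2 * s := by
  simp only [Squarefree, not_forall] at hsq
  obtain ⟨p, ⟨s, rfl⟩, hp⟩ := hsq
  obtain ⟨k, j, hkj, hk, hj⟩ := isHomogeneous_of_mul hr hr0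
  obtain ⟨k₁, k₂, hkk, h1, h2⟩ := isHomogeneous_of_mul hk (left_ne_zero_of_mul hr0)
  have hp0 : p ≠ 0 := left_ne_zero_of_mul (left_ne_zero_of_mul hr0)
  have := h1.inj_right h2 hp0
  refine ⟨k₁, j, p, s, ?_, by omega, h1, hj, hp0, by ring⟩
  by_contra! hlt
  obtain rfl : k₁ = 0 := by omega
  obtain ⟨c, rfl⟩ := exists_eq_C_of_isHomogeneous_zero h1
  exact hp ((isUnit_iff_ne_zero.2 (by simpa using hp0)).map C)

end Homogeneous

/-! ### Linear forms, dual points and the primes they generate -/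

section LinearForms

variable {σ K : Type*} [Field K]

theorem isHomogeneous_smul {f : MvPolynomial σ K} {k : ℕ} (hf : f.IsHomogeneous k) (c : K) :
    (c • f).IsHomogeneous k := by
  rw [smul_eq_C_mul]; exact hf.C_mul c

/-- Two linear maps that agree on the variables agree on linear forms. -/
theorem linearMap_eq_of_isHomogeneous_one {M : Type*} [AddCommGroup M] [Module K M]
    {f g : MvPolynomial σ K →ₗ[K] M} (h : ∀ i, f (X i) = g (X i)) {l : MvPolynomial σ K}
    (hl : l.IsHomogeneous 1) : f l = g l := by
  have hmem : l ∈ Submodule.span K (Set.range X) := by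
    rw [← homogeneousSubmodule_one_eq_span_X]; exact hl
  have : Set.EqOn f g (Set.range X) := by rintro _ ⟨i, rfl⟩; exact h i
  exact LinearMap.eqOn_span this hmem

theorem aeval_self_eq_eval (w : σ → K) (f : MvPolynomial σ K) : aeval w f = eval w f := by
  rw [← coe_aeval_eq_eval]; rfl

theorem dual_apply_eq_eval (φ : MvPolynomial σ K →ₗ[K] K) {l : MvPolynomial σ K}
    (hl : l.IsHomogeneous 1) : φ l = eval (fun i ↦ φ (X i)) l := by
  have := linearMap_eq_of_isHomogeneous_one (f := φ)
    (g := (aeval (R := K) fun i ↦ φ (X i)).toLinearMap) (by simp) hl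
  rwa [AlgHom.toLinearMap_apply, aeval_self_eq_eval] at this

/-- The derivation is the directional derivative along w. -/
theorem mkDerivation_eq_C_eval (w : σ → K) {l : MvPolynomial σ K} (hl : l.IsHomogeneous 1) :
    mkDerivation K (fun i ↦ (C (w i) : MvPolynomial σ K)) l = C (eval w l) := by
  have := linearMap_eq_of_isHomogeneous_one
    (f := (mkDerivation K (fun i ↦ (C (w i) : MvPolynomial σ K)) : _ →ₗ[K] _))
    (g := (Algebra.linearMap K (MvPolynomial σ K)) ∘ₗ (aeval (R := K) w).toLinearMap)
    (by simp [mkDerivation_X, algebraMap_eq]) hl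
  rwa [LinearMap.comp_apply, AlgHom.toLinearMap_apply, aeval_self_eq_eval] at this

/-- A coordinate functional of a basis extending x, read as evaluation at a point. -/
theorem exists_eval_eq_ite {ι : Type*} [DecidableEq ι] {x : ι → MvPolynomial σ K}
    (hx : ∀ i, (x i).IsHomogeneous 1) (hli : LinearIndependent K x) (i : ι) :
    ∃ w : σ → K, ∀ j, eval w (x j) = if j = i then 1 else 0 := by
  let b := Module.Basis.extend hli.linearIndepOn_id
  have hmem : ∀ j, x j ∈ hli.linearIndepOn_id.extend (Set.subset_univ _) := fun j ↦
    hli.linearIndepOn_id.subset_extend _ ⟨j, rfl⟩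
  let φ := b.coord ⟨x i, hmem i⟩
  refine ⟨fun k ↦ φ (X k), fun j ↦ ?_⟩
  rw [← dual_apply_eq_eval φ (hx j)]
  have hb : x j = b ⟨x j, hmem j⟩ := by simp [b]
  rw [hb]
  simp only [φ, Module.Basis.coord_apply, Module.Basis.repr_self]
  rcases eq_or_ne j i with rfl | hji
  · simp
  · rw [Finsupp.single_eq_of_ne, if_neg hji]
    simpa [hli.injective.eq_iff] using hji.symm

/-- Linearly independent linear forms generate the kernel of an endomorphism that fixes every
linear form vanishing at suitable points. -/
theorem exists_algHom_ker_eq_span {ι : Type*} [Fintype ι] [DecidableEq ι] {x : ι → MvPolynomial σ K}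
    {w : ι → σ → K} (hx : ∀ i, (x i).IsHomogeneous 1)
    (hw : ∀ i j, eval (w i) (x j) = if j = i then 1 else 0) :
    ∃ π : MvPolynomial σ K →ₐ[K] MvPolynomial σ K,
      RingHom.ker π = Ideal.span (Set.range x) ∧
      ∀ l : MvPolynomial σ K, l.IsHomogeneous 1 → π l = l - ∑ i, eval (w i) l • x i := by
  let π : MvPolynomial σ K →ₐ[K] MvPolynomial σ K := aeval fun k ↦ X k - ∑ i, w i k • x i
  have hπ : ∀ l : MvPolynomial σ K, l.IsHomogeneous 1 → π l = l - ∑ i, eval (w i) l • x i := by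
    intro l hl
    have := linearMap_eq_of_isHomogeneous_one (f := π.toLinearMap)
      (g := LinearMap.id - ∑ i, (aeval (R := K) (w i)).toLinearMap.smulRight (x i))
      (by simp [π]) hl
    simpa only [LinearMap.sub_apply, LinearMap.id_apply, LinearMap.sum_apply,
      LinearMap.smulRight_apply, AlgHom.toLinearMap_apply, aeval_self_eq_eval] using this
  refine ⟨π, le_antisymm (fun f hf ↦ ?_) ?_, hπ⟩
  -- π is the identity modulo the ideal, so π f = 0 forces f into it.
  · have h1 : (Ideal.Quotient.mkₐ K (Ideal.span (Set.range x))).comp π =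
        Ideal.Quotient.mkₐ K (Ideal.span (Set.range x)) := by
      refine algHom_ext fun k ↦ ?_
      simp only [AlgHom.comp_apply, Ideal.Quotient.mkₐ_eq_mk, π, aeval_X, map_sub, sub_eq_self]
      rw [Ideal.Quotient.eq_zero_iff_mem]
      refine Ideal.sum_mem _ fun i _ ↦ ?_
      rw [smul_eq_C_mul]
      exact Ideal.mul_mem_left _ _ (Ideal.subset_span ⟨i, rfl⟩)
    have h2 := DFunLike.congr_fun h1 f
    rw [RingHom.mem_ker] at hf
    have hf' : π f = 0 := hf
    simp only [AlgHom.comp_apply, hf', map_zero] at h2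
    exact Ideal.Quotient.eq_zero_iff_mem.1 h2.symm
  · rw [Ideal.span_le]
    rintro _ ⟨j, rfl⟩
    simp [RingHom.mem_ker, hπ _ (hx j), hw]

theorem isPrime_span_range {ι : Type*} [Fintype ι] {x : ι → MvPolynomial σ K}
    (hx : ∀ i, (x i).IsHomogeneous 1) (hli : LinearIndependent K x) :
    (Ideal.span (Set.range x)).IsPrime := by
  classical
  choose w hw using exists_eval_eq_ite hx hli
  obtain ⟨π, hπ, -⟩ := exists_algHom_ker_eq_span hx hw
  rw [← hπ]
  exact RingHom.ker_isPrime _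

theorem isPrime_span_pair {x y : MvPolynomial σ K} (hx : x.IsHomogeneous 1)
    (hy : y.IsHomogeneous 1) (hli : LinearIndependent K ![x, y]) :
    (Ideal.span {x, y}).IsPrime := by
  have := isPrime_span_range (x := ![x, y]) (by simp [Fin.forall_fin_two, hx, hy]) hli
  simpa [Set.pair_comm y x] using this

theorem prime_of_isHomogeneous_one {x : MvPolynomial σ K} (hx : x.IsHomogeneous 1) (h0 : x ≠ 0) :
    Prime x := by
  rw [← Ideal.span_singleton_prime h0]
  have := isPrime_span_range (x := ![x]) (by simp [hx]) (by simp [h0])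
  simpa using this

end LinearForms

/-! ### Rank two forms and their space Lin -/

section Lin

variable {K : Type*} [Field K] {n : ℕ}

/-- Any linear form occurring in one representation of an irreducible quadratic form by two
products lies in the span of the linear forms of any other such representation. -/
theorem mem_span_of_irreducible {Q a b x y a' b' x' y' : MvPolynomial (Fin n) K}
    (hQ : Irreducible Q) (ha : a.IsHomogeneous 1) (hb : b.IsHomogeneous 1)
    (hx : x.IsHomogeneous 1) (hy : y.IsHomogeneous 1) (ha' : a'.IsHomogeneous 1)
    (hb' : b'.IsHomogeneous 1) (hx' : x'.IsHomogeneous 1) (hy' : y'.IsHomogeneous 1)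
    (h : Q = a * x + b * y) (h' : Q = a' * x' + b' * y') :
    a' ∈ Submodule.span K {a, b, x, y} := by
  -- A functional vanishing on a, b, x, y but not on a' gives a direction w along which Q has zero
  -- value and zero derivative.
  by_contra hmem
  obtain ⟨φ, hφ, hle⟩ := Submodule.exists_le_ker_of_notMem hmem
  let w : Fin n → K := fun i ↦ φ (X i)
  have hker : ∀ l ∈ ({a, b, x, y} : Set (MvPolynomial (Fin n) K)), l.IsHomogeneous 1 →
      eval w l = 0 := fun l hl hl1 ↦ by
    rw [← dual_apply_eq_eval φ hl1]
    exact hle (Submodule.subset_span hl)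
  have ea := hker a (by simp) ha
  have eb := hker b (by simp) hb
  have ex := hker x (by simp) hx
  have ey := hker y (by simp) hy
  rw [dual_apply_eq_eval φ ha'] at hφ
  change eval w a' ≠ 0 at hφ
  have hev : eval w a' * eval w x' + eval w b' * eval w y' = 0 := by
    have := congrArg (eval w) (h'.symm.trans h)
    simpa [ea, eb] using this
  have hder := congrArg (mkDerivation K (fun i ↦ (C (w i) : MvPolynomial (Fin n) K)))
    (h'.symm.trans h)
  simp only [map_add, Derivation.leibniz, mkDerivation_eq_C_eval w ha, mkDerivation_eq_C_eval w hb,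
    mkDerivation_eq_C_eval w hx, mkDerivation_eq_C_eval w hy, mkDerivation_eq_C_eval w ha',
    mkDerivation_eq_C_eval w hb', mkDerivation_eq_C_eval w hx', mkDerivation_eq_C_eval w hy',
    ea, eb, ex, ey, smul_eq_mul, map_zero, mul_zero, add_zero] at hder
  generalize eval w a' = α at *
  generalize eval w x' = ξ at *
  generalize eval w b' = β at *
  generalize eval w y' = η at *
  have hαi : (C α * C α⁻¹ : MvPolynomial (Fin n) K) = 1 := by
    rw [← C_mul, mul_inv_cancel₀ hφ, C_1]
  have hev' : (C α * C ξ + C β * C η : MvPolynomial (Fin n) K) = 0 := by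
    rw [← C_mul, ← C_mul, ← C_add, hev, C_0]
  -- The vanishing derivative expresses x' through a', b', y'. Substituting, and using αξ + βη = 0,
  -- splits Q into two linear factors.
  have hfac : Q = (b' - C (α⁻¹ * β) * a') * (y' - C (α⁻¹ * η) * a') := by
    have h1 : C α * C α * Q = (C α * b' - C β * a') * (C α * y' - C η * a') := by
      rw [h']
      linear_combination C α * a' * hder - a' ^ 2 * hev'
    have h2 : Q = C α⁻¹ * C α⁻¹ * (C α * C α * Q) := by
      linear_combination (-C α * C α⁻¹ * Q - Q) * hαi
    rw [h2, h1]
    simp only [C_mul]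
    linear_combination ((b' * y') * (C α * C α⁻¹ + 1) - b' * C α⁻¹ * C η * a'
      - C α⁻¹ * C β * a' * y') * hαi
  rw [hfac] at hQ
  exact not_irreducible_mul (hb'.sub (ha'.C_mul _)) (hy'.sub (ha'.C_mul _)) one_ne_zero
    one_ne_zero hQ

theorem rank_eq_two {Q a b x y : MvPolynomial (Fin n) K} (hQ : Irreducible Q)
    (ha : a.IsHomogeneous 1) (hb : b.IsHomogeneous 1) (hx : x.IsHomogeneous 1)
    (hy : y.IsHomogeneous 1) (h : Q = a * x + b * y) : QuadraticForms.rank Q = 2 := by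
  have hmem : 2 ∈ {s : ℕ | ∃ a b : Fin s → MvPolynomial (Fin n) K,
      QuadraticForms.IsRepresentation Q s a b} :=
    ⟨![a, b], ![x, y], by simp [Fin.forall_fin_two, ha, hb], by simp [Fin.forall_fin_two, hx, hy],
      by simp [h]⟩
  have hle : QuadraticForms.rank Q ≤ 2 := Nat.sInf_le hmem
  have hrank : QuadraticForms.rank Q ∈ {s : ℕ | ∃ a b : Fin s → MvPolynomial (Fin n) K,
      QuadraticForms.IsRepresentation Q s a b} := Nat.sInf_mem ⟨2, hmem⟩
  generalize QuadraticForms.rank Q = r at hle hrank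
  obtain ⟨f, g, hf, hg, hfg⟩ := hrank
  interval_cases r
  · exact absurd (by simpa using hfg) hQ.ne_zero
  · rw [Fin.sum_univ_one] at hfg
    exact absurd (hfg ▸ hQ) (not_irreducible_mul (hf 0) (hg 0) one_ne_zero one_ne_zero)
  · rfl

theorem lin_eq_span {Q a b x y : MvPolynomial (Fin n) K} (hQ : Irreducible Q)
    (ha : a.IsHomogeneous 1) (hb : b.IsHomogeneous 1) (hx : x.IsHomogeneous 1)
    (hy : y.IsHomogeneous 1) (h : Q = a * x + b * y) :
    QuadraticForms.Lin Q = Submodule.span K {a, b, x, y} := by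
  have hr := rank_eq_two hQ ha hb hx hy h
  rw [QuadraticForms.Lin, if_neg (by omega), QuadraticForms.linSpan, hr]
  refine le_antisymm (Submodule.span_le.2 ?_) (Submodule.span_mono ?_)
  · rintro l ⟨f, g, ⟨hf, hg, hfg⟩, i, hi⟩
    rw [Fin.sum_univ_two] at hfg
    -- Permuting summands and factors brings each of the four linear forms into the role of a'.
    have key := @mem_span_of_irreducible K _ n Q a b x y
    obtain rfl | rfl : i = 0 ∨ i = 1 := by omega
    all_goals rcases hi with rfl | rfl
    · exact key hQ ha hb hx hy (hf 0) (hf 1) (hg 0) (hg 1) h hfg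
    · exact key hQ ha hb hx hy (hg 0) (hf 1) (hf 0) (hg 1) h (by rw [hfg]; ring)
    · exact key hQ ha hb hx hy (hf 1) (hf 0) (hg 1) (hg 0) h (by rw [hfg]; ring)
    · exact key hQ ha hb hx hy (hg 1) (hf 0) (hf 1) (hg 0) h (by rw [hfg]; ring)
  · have h1 : QuadraticForms.IsRepresentation Q 2 ![a, b] ![x, y] :=
      ⟨by simp [Fin.forall_fin_two, ha, hb], by simp [Fin.forall_fin_two, hx, hy], by simp [h]⟩
    intro l hl
    refine ⟨_, _, h1, ?_⟩
    rcases hl with rfl | rfl | rfl | rfl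
    · exact ⟨0, by simp⟩
    · exact ⟨1, by simp⟩
    · exact ⟨0, by simp⟩
    · exact ⟨1, by simp⟩

theorem not_irreducible_binary [IsAlgClosed K] {x y : MvPolynomial (Fin n) K}
    (hx : x.IsHomogeneous 1) (hy : y.IsHomogeneous 1) (α β γ : K) :
    ¬ Irreducible (α • x ^ 2 + β • (x * y) + γ • y ^ 2) := by
  by_cases hα : α = 0
  · have : α • x ^ 2 + β • (x * y) + γ • y ^ 2 = y * (β • x + γ • y) := by
      simp only [hα, smul_eq_C_mul, C_0]; ring
    rw [this]
    exact not_irreducible_mul hy ((isHomogeneous_smul hx _).add (isHomogeneous_smul hy _))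
      one_ne_zero one_ne_zero
  · obtain ⟨t, ht⟩ := IsAlgClosed.exists_root
      (Polynomial.C α * Polynomial.X ^ 2 + Polynomial.C β * Polynomial.X + Polynomial.C γ)
      (by rw [Polynomial.degree_quadratic hα]; decide)
    simp only [Polynomial.IsRoot, Polynomial.eval_add, Polynomial.eval_mul, Polynomial.eval_C,
      Polynomial.eval_pow, Polynomial.eval_X] at ht
    have ht' : (C α * C t ^ 2 + C β * C t + C γ : MvPolynomial (Fin n) K) = 0 := by
      simp only [← C_mul, ← C_pow, ← C_add, ht, C_0]
    have : α • x ^ 2 + β • (x * y) + γ • y ^ 2 =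
        (x - t • y) * (α • x + (α * t + β) • y) := by
      simp only [smul_eq_C_mul, C_add, C_mul]
      linear_combination y ^ 2 * ht'
    rw [this]
    exact not_irreducible_mul (hx.sub (isHomogeneous_smul hy _))
      ((isHomogeneous_smul hx _).add (isHomogeneous_smul hy _)) one_ne_zero one_ne_zero

/-- If some member of the pencil of two irreducible quadratic forms in the ideal `(x, y)` is a
quadratic form in `x` and `y` alone, then the two forms have the same `Lin`. -/
theorem lin_eq_lin_of_binary_member [IsAlgClosed K] {Q₁ Q₂ a b x y : MvPolynomial (Fin n) K}
    (hQ₁ : Irreducible Q₁) (hQ₂ : Irreducible Q₂)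
    (ha : a.IsHomogeneous 1) (hb : b.IsHomogeneous 1) (hx : x.IsHomogeneous 1)
    (hy : y.IsHomogeneous 1) (h : Q₁ = a * x + b * y) {r s α β γ : K} (hrs : r ≠ 0 ∨ s ≠ 0)
    (hF : r • Q₁ + s • Q₂ = α • x ^ 2 + β • (x * y) + γ • y ^ 2) :
    QuadraticForms.Lin Q₁ = QuadraticForms.Lin Q₂ := by
  -- Binary forms are reducible, so neither coefficient r nor s of the pencil member can vanish.
  have key : ∀ {Q : MvPolynomial (Fin n) K} {c : K}, Irreducible Q → c ≠ 0 →
      c • Q ≠ α • x ^ 2 + β • (x * y) + γ • y ^ 2 := by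
    intro Q c hQ hc he
    apply not_irreducible_binary hx hy α β γ
    rw [← he, smul_eq_C_mul]
    exact (irreducible_isUnit_mul ((isUnit_iff_ne_zero.2 hc).map C)).2 hQ
  have hs : s ≠ 0 := by
    rintro rfl
    exact key hQ₁ (hrs.resolve_right (by simp)) (by simpa using hF)
  have hr : r ≠ 0 := by
    rintro rfl
    exact key hQ₂ hs (by simpa using hF)
  -- Solving for Q₂ puts it in (x, y) too; its cofactors agree with multiples of a and b modulo x
  -- and y.
  have h2 : Q₂ = (s⁻¹ • (-r • a + α • x + β • y)) * x + (s⁻¹ • (-r • b + γ • y)) * y := by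
    have : Q₂ = s⁻¹ • (s • Q₂) := by rw [smul_smul, inv_mul_cancel₀ hs, one_smul]
    rw [this, eq_sub_of_add_eq' hF, h]
    simp only [smul_eq_C_mul, C_neg]
    ring
  have ha' : (s⁻¹ • (-r • a + α • x + β • y)).IsHomogeneous 1 :=
    isHomogeneous_smul (((isHomogeneous_smul ha _).add (isHomogeneous_smul hx _)).add
      (isHomogeneous_smul hy _)) _
  have hb' : (s⁻¹ • (-r • b + γ • y)).IsHomogeneous 1 :=
    isHomogeneous_smul ((isHomogeneous_smul hb _).add (isHomogeneous_smul hy _)) _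
  rw [lin_eq_span hQ₁ ha hb hx hy h, lin_eq_span hQ₂ ha' hb' hx hy h2]
  set a' := s⁻¹ • (-r • a + α • x + β • y) with ha'd
  set b' := s⁻¹ • (-r • b + γ • y) with hb'd
  have hea : a = r⁻¹ • (α • x + β • y - s • a') := by
    rw [ha'd, smul_smul, mul_inv_cancel₀ hs, one_smul]
    match_scalars <;> field_simp <;> ring
  have heb : b = r⁻¹ • (γ • y - s • b') := by
    rw [hb'd, smul_smul, mul_inv_cancel₀ hs, one_smul]
    match_scalars <;> field_simp <;> ring
  apply le_antisymm <;> rw [Submodule.span_le]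
  · have m1 : a' ∈ Submodule.span K {a', b', x, y} := Submodule.subset_span (by simp)
    have m2 : b' ∈ Submodule.span K {a', b', x, y} := Submodule.subset_span (by simp)
    have m3 : x ∈ Submodule.span K {a', b', x, y} := Submodule.subset_span (by simp)
    have m4 : y ∈ Submodule.span K {a', b', x, y} := Submodule.subset_span (by simp)
    rintro l (rfl | rfl | rfl | rfl)
    · rw [hea]
      exact Submodule.smul_mem _ _ (Submodule.sub_mem _ (Submodule.add_mem _
        (Submodule.smul_mem _ _ m3) (Submodule.smul_mem _ _ m4)) (Submodule.smul_mem _ _ m1))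
    · rw [heb]
      exact Submodule.smul_mem _ _ (Submodule.sub_mem _
        (Submodule.smul_mem _ _ m4) (Submodule.smul_mem _ _ m2))
    · exact m3
    · exact m4
  · have m1 : a ∈ Submodule.span K {a, b, x, y} := Submodule.subset_span (by simp)
    have m2 : b ∈ Submodule.span K {a, b, x, y} := Submodule.subset_span (by simp)
    have m3 : x ∈ Submodule.span K {a, b, x, y} := Submodule.subset_span (by simp)
    have m4 : y ∈ Submodule.span K {a, b, x, y} := Submodule.subset_span (by simp)
    rintro l (rfl | rfl | rfl | rfl)
    · exact Submodule.smul_mem _ _ (Submodule.add_mem _ (Submodule.add_mem _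
        (Submodule.smul_mem _ _ m1) (Submodule.smul_mem _ _ m3)) (Submodule.smul_mem _ _ m4))
    · exact Submodule.smul_mem _ _ (Submodule.add_mem _
        (Submodule.smul_mem _ _ m2) (Submodule.smul_mem _ _ m4))
    · exact m3
    · exact m4

end Lin

/-! ### Primary components over a minimal prime -/

section PrimaryComponent

/-- If a primary ideal `q ≥ I` over a minimal prime `p` of `I` lies in every primary ideal over
`p` containing `I`, then it is the `p`-primary component of `I`. -/
theorem isPrimaryComponent_of_forall_le {R : Type*} [CommRing R] [IsNoetherianRing R]
    {I p q : Ideal R} (hp : p ∈ I.minimalPrimes) (hIq : I ≤ q) (hq : q.IsPrimary)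
    (hqp : q.radical = p) (hle : ∀ q' : Ideal R, q'.IsPrimary → q'.radical = p → I ≤ q' → q ≤ q') :
    QuadraticForms.IsPrimaryComponent I p q := by
  refine ⟨hp, ?_⟩
  obtain ⟨t, ht⟩ :=
    Submodule.IsLasker.exists_isMinimalPrimaryDecomposition (Submodule.isLasker R R) I
  refine ⟨t, ht, ?_⟩
  obtain ⟨q', hq't, hq'p⟩ :=
    Ideal.IsMinimalPrimaryDecomposition.minimalPrimes_subset_image_radical ht hp
  have hIle : ∀ J ∈ t, I ≤ J := fun J hJ ↦ ht.inf_eq.symm.trans_le (Finset.inf_le hJ)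
  suffices h : q' = q by exact ⟨h ▸ hq't, hqp⟩
  refine le_antisymm (fun f hf ↦ ?_) (hle q' (ht.primary hq't) hq'p (hIle q' hq't))
  have hpp : p.IsPrime := hp.1.1
  -- A component other than q' inside p would have radical p by minimality, but the radicals in t
  -- are distinct.
  have hnot : ¬ (t.erase q').inf id ≤ p := by
    rw [hpp.inf_le']
    rintro ⟨(J : Ideal R), hJ, hJp⟩
    have hJt := Finset.mem_of_mem_erase hJ
    have hJrad : J.radical ≤ p := hpp.radical_le_iff.2 hJp
    have hJprime : J.radical.IsPrime := Ideal.isPrime_radical (ht.primary hJt)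
    have heq : J.radical = p := le_antisymm hJrad
      (hp.2 ⟨hJprime, (hIle J hJt).trans Ideal.le_radical⟩ hJrad)
    refine ht.distinct hJt hq't (Finset.ne_of_mem_erase hJ) ?_
    simp only [Submodule.colon_univ]
    exact heq.trans hq'p.symm
  -- This s lies in all other components but not in p: it multiplies q' into I ≤ q, and q being
  -- p-primary absorbs it.
  obtain ⟨s, hs, hsp⟩ := SetLike.not_le_iff_exists.1 hnot
  have hsf : f * s ∈ I := by
    rw [← ht.inf_eq, Submodule.mem_finsetInf]
    rw [Submodule.mem_finsetInf] at hs
    intro J hJ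
    by_cases hJq : J = q'
    · subst hJq; exact Ideal.mul_mem_right _ _ hf
    · exact Ideal.mul_mem_left _ _ (hs J (Finset.mem_erase.2 ⟨hJq, hJ⟩))
  have := (Ideal.isPrimary_iff.1 hq).2 (hIq hsf)
  rw [hqp] at this
  exact this.resolve_right hsp

variable {K : Type*} [Field K] {σ : Type*}

theorem radical_span_pair_sq {x y : MvPolynomial σ K} (hx : x.IsHomogeneous 1)
    (hy : y.IsHomogeneous 1) (hli : LinearIndependent K ![x, y]) :
    (Ideal.span {x, y ^ 2}).radical = Ideal.span {x, y} := by
  have hp := isPrime_span_pair hx hy hli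
  apply le_antisymm
  · rw [hp.radical_le_iff, Ideal.span_le, Set.insert_subset_iff, Set.singleton_subset_iff]
    exact ⟨Ideal.subset_span (by simp),
      Ideal.pow_mem_of_mem _ (Ideal.subset_span (by simp)) 2 two_pos⟩
  · rw [Ideal.span_le, Set.insert_subset_iff, Set.singleton_subset_iff]
    exact ⟨Ideal.le_radical (Ideal.subset_span (by simp)), 2, Ideal.subset_span (by simp)⟩

/-- A retraction π with kernel (x) fixing y reduces the claim to the ideal (y²), which is primary
because y is prime. -/
theorem isPrimary_span_pair_sq {x y : MvPolynomial σ K} (hx : x.IsHomogeneous 1)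
    (hy : y.IsHomogeneous 1) (hli : LinearIndependent K ![x, y]) :
    (Ideal.span {x, y ^ 2}).IsPrimary := by
  have hp := isPrime_span_pair hx hy hli
  have hrad := radical_span_pair_sq hx hy hli
  refine Ideal.isPrimary_iff.2 ⟨fun h ↦ hp.ne_top ?_, fun {f g} hfg ↦ ?_⟩
  · rw [← hrad, h, Ideal.radical_top]
  rw [hrad, or_iff_not_imp_right]
  intro hg
  have hxy : ∀ i, (![x, y] i).IsHomogeneous 1 := by simp [Fin.forall_fin_two, hx, hy]
  obtain ⟨w, hw⟩ := exists_eval_eq_ite hxy hli 0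
  have hwx : eval w x = 1 := by simpa using hw 0
  have hwy : eval w y = 0 := by simpa using hw 1
  obtain ⟨π, hπ, hπl⟩ := exists_algHom_ker_eq_span (x := fun _ : Unit ↦ x) (w := fun _ ↦ w)
    (by simp [hx]) (by simp [hwx])
  rw [Set.range_const] at hπ
  have hπx : π x = 0 := by simp [hπl x hx, hwx]
  have hπy : π y = y := by simp [hπl y hy, hwy]
  have hmem : ∀ (k : ℕ) (f : MvPolynomial σ K), y ^ k ∣ π f → f ∈ Ideal.span {x, y ^ k} := by
    rintro k f ⟨c, hc⟩
    have hππ : ∀ f, π (π f) = π f := by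
      intro f
      have : (π.comp π) = π := by
        refine algHom_ext fun i ↦ ?_
        rw [AlgHom.comp_apply, hπl _ (isHomogeneous_X K i)]
        simp [hπx, hπl _ (isHomogeneous_X K i)]
      exact DFunLike.congr_fun this f
    have h1 : f - π f ∈ Ideal.span {x} := by
      rw [← hπ, RingHom.mem_ker]
      change π (f - π f) = 0
      rw [map_sub, hππ, sub_self]
    have h2 : π f ∈ Ideal.span {x, y ^ k} := by
      rw [hc]; exact Ideal.mul_mem_right _ _ (Ideal.subset_span (by simp))
    simpa using Ideal.add_mem _ (Ideal.span_mono (by simp) h1) h2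
  have hdvd : y ^ 2 ∣ π f * π g := by
    obtain ⟨u, v, huv⟩ := Ideal.mem_span_pair.1 hfg
    refine ⟨π v, ?_⟩
    rw [← map_mul, ← huv]
    simp [hπx, hπy, mul_comm]
  have hyg : ¬ y ∣ π g := fun h ↦ hg (by simpa using hmem 1 g (by simpa using h))
  have hyp : Prime y := prime_of_isHomogeneous_one hy (by simpa using hli.ne_zero 1)
  exact hmem 2 f (hyp.pow_dvd_of_dvd_mul_right 2 hyg hdvd)

end PrimaryComponent

/-! ### The two configurations of a pencil -/

section Configurations

variable {K σ : Type*} [Field K]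

/-- Some nonzero member of the pencil of `Q₁` and `Q₂` is a quadratic form in two linear forms
`x` and `y` with `Q₁ ∈ (x, y)`. -/
def HasBinaryMember (Q₁ Q₂ : MvPolynomial σ K) : Prop :=
  ∃ (x y a b : MvPolynomial σ K) (r s α β γ : K), x.IsHomogeneous 1 ∧ y.IsHomogeneous 1 ∧
    a.IsHomogeneous 1 ∧ b.IsHomogeneous 1 ∧ Q₁ = a * x + b * y ∧ (r ≠ 0 ∨ s ≠ 0) ∧
    r • Q₁ + s • Q₂ = α • x ^ 2 + β • (x * y) + γ • y ^ 2

/-- Modulo some linear form `x`, both forms are scalar multiples of the square of the same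
linear form. -/
def AreTangent (Q₁ Q₂ : MvPolynomial σ K) : Prop :=
  ∃ (x y a b : MvPolynomial σ K) (α β : K), x.IsHomogeneous 1 ∧ y.IsHomogeneous 1 ∧
    a.IsHomogeneous 1 ∧ b.IsHomogeneous 1 ∧ Q₁ = a * x + α • y ^ 2 ∧ Q₂ = b * x + β • y ^ 2

theorem isRadical_span_pair_of_map {R S : Type*} [CommRing R] [CommRing S] (e : R ≃+* S)
    {a b : R} (h : (Ideal.span {e a, e b}).IsRadical) : (Ideal.span {a, b}).IsRadical := by
  rintro f ⟨k, hk⟩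
  have himg : Ideal.span {e a, e b} = (Ideal.span {a, b}).map (e : R →+* S) := by
    rw [Ideal.map_span, Set.image_pair]; rfl
  have h1 : e f ∈ (Ideal.span {a, b}).map (e : R →+* S) := by
    rw [← himg]
    refine h ⟨k, ?_⟩
    rw [← map_pow, himg]
    exact Ideal.mem_map_of_mem (e : R →+* S) hk
  obtain ⟨g, hg, hgf⟩ := (Ideal.mem_map_of_equiv e (e f)).1 h1
  rwa [← e.injective hgf]

theorem exists_pow_two_eq [IsAlgClosed K] {c : K} : ∃ t : K, c = t ^ 2 :=
  (IsAlgClosed.exists_pow_nat_eq c two_pos).imp fun _ h ↦ h.symm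

end Configurations

/-! ### Analysis of the pencil of z² - D and l z + q -/

section NormalForm

variable {K : Type*} [Field K] {m : ℕ}

theorem finSuccEquiv_rename_succ (f : MvPolynomial (Fin m) K) :
    finSuccEquiv K m (rename Fin.succ f) = Polynomial.C f := by
  induction f using MvPolynomial.induction_on with
  | C a => rw [rename_C]; exact (finSuccEquiv K m).commutes a
  | add p q hp hq => simp [hp, hq]
  | mul_X p i hp => simp [hp, finSuccEquiv_X_succ]

theorem X_zero_add_rename_succ_ne_zero (f : MvPolynomial (Fin m) K) :
    (X 0 + rename Fin.succ f : MvPolynomial (Fin (m + 1)) K) ≠ 0 := by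
  intro h
  have := congrArg (finSuccEquiv K m) h
  rw [map_add, finSuccEquiv_rename_succ, finSuccEquiv_X_zero, map_zero] at this
  exact Polynomial.X_add_C_ne_zero _ this

theorem isRadical_of_finSuccEquiv {D l q : MvPolynomial (Fin m) K}
    (h : (Ideal.span {Polynomial.X ^ 2 - Polynomial.C D,
      Polynomial.C l * Polynomial.X + Polynomial.C q}).IsRadical) :
    (Ideal.span {(X 0 ^ 2 - rename Fin.succ D : MvPolynomial (Fin (m + 1)) K),
      rename Fin.succ l * X 0 + rename Fin.succ q}).IsRadical := by
  refine isRadical_span_pair_of_map (finSuccEquiv K m).toRingEquiv ?_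
  convert! h using 4 <;> simp [finSuccEquiv_rename_succ, finSuccEquiv_X_zero]

variable {D l q : MvPolynomial (Fin m) K}

local notation "ι" => rename (R := K) (Fin.succ : Fin m → Fin (m + 1))

theorem isUnit_two_mvPolynomial {σ : Type*} [CharZero K] : IsUnit (2 : MvPolynomial σ K) := by
  have := (isUnit_iff_ne_zero.2 (two_ne_zero (α := K))).map (C : K →+* MvPolynomial σ K)
  rwa [map_ofNat] at this

/-- The pencil of `z² - D` and a form `q` that does not involve the variable `z`. -/
theorem areTangent_of_not_isRadical_of_linear_eq_zero [IsAlgClosed K] [CharZero K]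
    (hD : D.IsHomogeneous 2) (hq : q.IsHomogeneous 2)
    (hirr : Irreducible (X 0 ^ 2 - ι D))
    (hrad : ¬ (Ideal.span {X 0 ^ 2 - ι D, ι q}).IsRadical)
    (hsq : ∀ h : MvPolynomial (Fin (m + 1)) K, h.IsHomogeneous 1 → h ≠ 0 →
      h ^ 2 ∉ Submodule.span K {X 0 ^ 2 - ι D, ι q}) :
    AreTangent (X 0 ^ 2 - ι D) (ι q) := by
  have hq0 : q ≠ 0 := by
    rintro rfl
    refine hrad ?_
    have : Ideal.span {X 0 ^ 2 - ι D, ι 0} = Ideal.span {X 0 ^ 2 - ι D} := by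
      rw [map_zero, Ideal.span_pair_zero]
    rw [this]
    exact ((Ideal.span_singleton_prime hirr.ne_zero).2 hirr.prime).isRadical
  -- A quadratic form with a repeated factor is c p² with p linear, hence a square since c has a
  -- square root.
  have hqs : Squarefree q := by
    by_contra hns
    obtain ⟨k, j, p, s, hk, hkj, hp, hs, hp0, rfl⟩ := exists_sq_mul_of_not_squarefree hq hq0 hns
    obtain ⟨rfl, rfl⟩ : k = 1 ∧ j = 0 := by omega
    obtain ⟨c, rfl⟩ := exists_eq_C_of_isHomogeneous_zero hs
    obtain ⟨t, rfl⟩ := exists_pow_two_eq (c := c)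
    have ht : t ≠ 0 := by rintro rfl; simp at hq0
    refine hsq (t • ι p) (isHomogeneous_smul hp.rename_isHomogeneous _) ?_ ?_
    · rw [Ne, smul_eq_zero, not_or]
      exact ⟨ht, (map_ne_zero_iff _ (rename_injective _ (Fin.succ_injective _))).2 hp0⟩
    · refine Submodule.mem_span_pair.2 ⟨0, 1, ?_⟩
      simp only [smul_eq_C_mul, map_mul, map_pow, rename_C, C_0, C_1]; ring
  have hrel : ¬ IsRelPrime q D := by
    intro hrel
    refine hrad ?_
    have h := isRadical_span_of_squarefree_of_isRelPrime isUnit_two_mvPolynomial hqs hrel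
    have := isRadical_of_finSuccEquiv (l := 0) (by simpa using h)
    simpa using this
  simp only [IsRelPrime, not_forall] at hrel
  obtain ⟨d, ⟨e, rfl⟩, hdD, hd⟩ := hrel
  obtain ⟨k, j, hkj, hdk, hej⟩ := isHomogeneous_of_mul hq hq0
  obtain ⟨h, hh, rfl⟩ := exists_isHomogeneous_of_dvd j hdk (by rwa [hkj]) hdD
  have hk0 : k ≠ 0 := by
    rintro rfl
    obtain ⟨c, rfl⟩ := exists_eq_C_of_isHomogeneous_zero hdk
    exact hd ((isUnit_iff_ne_zero.2 (by simpa using left_ne_zero_of_mul hq0)).map C)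
  obtain ⟨rfl, rfl⟩ | ⟨rfl, rfl⟩ : (k = 1 ∧ j = 1) ∨ (k = 2 ∧ j = 0) := by omega
  -- A common linear factor d of q and D: both forms are multiples of z² modulo d.
  · refine ⟨ι d, X 0, - ι h, ι e, 1, 0, hdk.rename_isHomogeneous, isHomogeneous_X _ _,
      hh.rename_isHomogeneous.neg, hej.rename_isHomogeneous, ?_, ?_⟩
    · rw [map_mul, one_smul]; ring
    · rw [map_mul, zero_smul]; ring
  -- Here D is a scalar multiple of q, so z² itself lies in the pencil.
  · obtain ⟨c, rfl⟩ := exists_eq_C_of_isHomogeneous_zero hej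
    obtain ⟨c', rfl⟩ := exists_eq_C_of_isHomogeneous_zero hh
    have hc : c ≠ 0 := by rintro rfl; simp at hq0
    refine absurd (Submodule.mem_span_pair.2 ⟨1, c' * c⁻¹, ?_⟩)
      (hsq (X 0) (isHomogeneous_X _ _) (X_ne_zero _))
    have hcc : (C c⁻¹ * C c : MvPolynomial (Fin (m + 1)) K) = 1 := by
      rw [← C_mul, inv_mul_cancel₀ hc, C_1]
    simp only [smul_eq_C_mul, map_mul, rename_C, C_1]
    linear_combination ι d * C c' * hcc

/-- The pencil of `z² - D` and `l (z + e)`. -/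
theorem configuration_of_not_isRadical_of_dvd [CharZero K] {e : MvPolynomial (Fin m) K}
    (hD : D.IsHomogeneous 2) (hl : l.IsHomogeneous 1) (hl0 : l ≠ 0) (he : e.IsHomogeneous 1)
    (hirr : Irreducible (X 0 ^ 2 - ι D))
    (hrad : ¬ (Ideal.span {X 0 ^ 2 - ι D, ι l * X 0 + ι (l * e)}).IsRadical) :
    HasBinaryMember (X 0 ^ 2 - ι D) (ι l * X 0 + ι (l * e)) ∨
      AreTangent (X 0 ^ 2 - ι D) (ι l * X 0 + ι (l * e)) := by
  have hz : (X 0 : MvPolynomial (Fin (m + 1)) K).IsHomogeneous 1 := isHomogeneous_X _ _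
  have hze := hz.add (he.rename_isHomogeneous (f := Fin.succ))
  have hze' := hz.sub (he.rename_isHomogeneous (f := Fin.succ))
  have hlp := prime_of_isHomogeneous_one hl hl0
  have hE : (e ^ 2 - D).IsHomogeneous 2 := (he.pow 2).sub hD
  by_cases hlD : l ∣ D
  · right
    obtain ⟨h, hh, rfl⟩ := exists_isHomogeneous_of_dvd 1 hl hD hlD
    refine ⟨ι l, X 0, - ι h, X 0 + ι e, 1, 0, hl.rename_isHomogeneous, hz,
      hh.rename_isHomogeneous.neg, hze, ?_, ?_⟩
    · rw [map_mul, one_smul]; ring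
    · rw [map_mul, zero_smul]; ring
  by_cases hlE : l ∣ e ^ 2 - D
  · left
    obtain ⟨h, hh, hlh⟩ := exists_isHomogeneous_of_dvd 1 hl hE hlE
    obtain rfl : D = e ^ 2 - l * h := by linear_combination -hlh
    -- Here z² - D = (z - e)(z + e) + l h, and l (z + e) is itself the binary member.
    refine ⟨ι l, X 0 + ι e, ι h, X 0 - ι e, 0, 1, 0, 1, 0, hl.rename_isHomogeneous, hze,
      hh.rename_isHomogeneous, hze', ?_, by simp, ?_⟩
    · simp only [map_sub, map_mul, map_pow]; ring
    · simp only [map_sub, map_mul, map_pow, zero_smul, one_smul]; ring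
  have hE0 : e ^ 2 - D ≠ 0 := by
    intro h0
    obtain rfl : D = e ^ 2 := by linear_combination -h0
    refine not_irreducible_mul hze hze' one_ne_zero one_ne_zero ?_
    convert! hirr using 1
    rw [map_pow]; ring
  have hns : ¬ Squarefree (e ^ 2 - D) := fun hs ↦ hrad (isRadical_of_finSuccEquiv
    (isRadical_span_of_squarefree_of_not_dvd isUnit_two_mvPolynomial hlp hlD hlE hs))
  right
  obtain ⟨k, j, p, s, hk, hkj, hp, hs, hp0, hE'⟩ := exists_sq_mul_of_not_squarefree hE hE0 hns
  obtain ⟨rfl, rfl⟩ : k = 1 ∧ j = 0 := by omega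
  obtain ⟨c, rfl⟩ := exists_eq_C_of_isHomogeneous_zero hs
  obtain rfl : D = e ^ 2 - p ^ 2 * C c := by linear_combination -hE'
  -- Here z² - D = (z - e)(z + e) + c p², so both forms are multiples of p² modulo z + e.
  refine ⟨X 0 + ι e, ι p, X 0 - ι e, ι l, c, 0, hze, hp.rename_isHomogeneous, hze',
    hl.rename_isHomogeneous, ?_, ?_⟩
  · simp only [map_sub, map_mul, map_pow, rename_C, smul_eq_C_mul]; ring
  · simp only [map_mul, zero_smul]; ring

/-- From (q - p)(q + p) = D l² and l ∤ 2q, all of l² divides one factor, so q - p = c l² after a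
sign choice. Then (z² - D) + 2c (l z + q) = (z + c l)². -/
theorem exists_sq_mem_span_of_norm_eq_sq [CharZero K] {p : MvPolynomial (Fin m) K}
    (hq : q.IsHomogeneous 2) (hl : l.IsHomogeneous 1)
    (hl0 : l ≠ 0) (hlq : ¬ l ∣ q) (hp : p.IsHomogeneous 2) (h : q ^ 2 - D * l ^ 2 = p ^ 2) :
    ∃ h : MvPolynomial (Fin (m + 1)) K, h.IsHomogeneous 1 ∧ h ≠ 0 ∧
      h ^ 2 ∈ Submodule.span K {X 0 ^ 2 - ι D, ι l * X 0 + ι q} := by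
  have hlp := prime_of_isHomogeneous_one hl hl0
  wlog hdvd : l ∣ q - p generalizing p with H
  · refine H hp.neg (by rw [h]; ring) ?_
    have : l ∣ (q - p) * (q + p) := ⟨D * l, by linear_combination h⟩
    simpa using (hlp.dvd_or_dvd this).resolve_left hdvd
  have hndvd : ¬ l ∣ q + p := by
    intro h2
    refine hlq ?_
    rw [← isUnit_two_mvPolynomial.dvd_mul_left]
    convert! dvd_add hdvd h2 using 1
    ring
  have hdvd2 : l ^ 2 ∣ q - p :=
    hlp.pow_dvd_of_dvd_mul_right 2 hndvd ⟨D, by linear_combination h⟩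
  obtain ⟨c', hc', hc⟩ := exists_isHomogeneous_of_dvd 0 (hl.pow 2) (hq.sub hp) hdvd2
  obtain ⟨c, rfl⟩ := exists_eq_C_of_isHomogeneous_zero hc'
  obtain rfl : D = C c * (2 * q - C c * l ^ 2) := by
    refine mul_left_cancel₀ (pow_ne_zero 2 hl0) ?_
    linear_combination -h + (q + p) * hc - l ^ 2 * C c * hc
  refine ⟨X 0 + ι (c • l), (isHomogeneous_X _ _).add
    (isHomogeneous_smul hl c).rename_isHomogeneous, X_zero_add_rename_succ_ne_zero _, ?_⟩
  refine Submodule.mem_span_pair.2 ⟨1, 2 * c, ?_⟩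
  simp only [smul_eq_C_mul, map_mul, map_sub, map_pow, rename_C, C_1, map_ofNat]
  ring

/-- The double factor p of the norm lifts to a codimension two subspace z + e = p = 0 on which both
forms vanish: q = l e + p k and D = e² - p h. That p² divides the norm then says p ∣ 2 e k + l h, so
e k lies in the prime (l, p). If e does, the pencil has a binary member; if k does, the forms are
tangent. -/
theorem configuration_of_sq_dvd_norm [CharZero K] {p : MvPolynomial (Fin m) K}
    (hD : D.IsHomogeneous 2) (hl : l.IsHomogeneous 1) (hq : q.IsHomogeneous 2)
    (hl0 : l ≠ 0) (hlq : ¬ l ∣ q) (hp : p.IsHomogeneous 1) (hp0 : p ≠ 0)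
    (h : p ^ 2 ∣ q ^ 2 - D * l ^ 2) :
    HasBinaryMember (X 0 ^ 2 - ι D) (ι l * X 0 + ι q) ∨
      AreTangent (X 0 ^ 2 - ι D) (ι l * X 0 + ι q) := by
  have hz : (X 0 : MvPolynomial (Fin (m + 1)) K).IsHomogeneous 1 := isHomogeneous_X _ _
  have hlp := prime_of_isHomogeneous_one hl hl0
  have hpp := prime_of_isHomogeneous_one hp hp0
  obtain ⟨s, hs⟩ := h
  have hpl : ¬ p ∣ l := by
    intro hpl
    obtain ⟨c', hc', rfl⟩ := exists_isHomogeneous_of_dvd 0 hp hl hpl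
    obtain ⟨c, rfl⟩ := exists_eq_C_of_isHomogeneous_zero hc'
    have hc : IsUnit (C c : MvPolynomial (Fin m) K) :=
      (isUnit_iff_ne_zero.2 (by rintro rfl; simp at hl0)).map C
    refine hlq (hc.mul_right_dvd.2 (hpp.dvd_of_dvd_pow (n := 2) ?_))
    exact ⟨p * s + D * p * C c ^ 2, by linear_combination hs⟩
  have hli : LinearIndependent K ![l, p] := by
    rw [LinearIndependent.pair_iff' hl0]
    rintro a rfl
    have ha : a ≠ 0 := by rintro rfl; simp at hp0
    refine hpl ⟨C a⁻¹, ?_⟩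
    rw [smul_eq_C_mul, mul_right_comm, ← C_mul, mul_inv_cancel₀ ha, C_1, one_mul]
  have hI := isPrime_span_pair hl hp hli
  have hqI : q ∈ Ideal.span {l, p} := by
    refine hI.mem_of_pow_mem 2 (Ideal.mem_span_pair.2 ⟨D * l, p * s, ?_⟩)
    linear_combination -hs
  obtain ⟨e, k, he, hk, rfl⟩ := exists_isHomogeneous_of_mem_span_pair 1 hl hp hq hqI
  have hpe : p ∣ e ^ 2 - D := by
    have : p ∣ l ^ 2 * (e ^ 2 - D) :=
      ⟨p * s - 2 * l * e * k - p * k ^ 2, by linear_combination hs⟩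
    exact (hpp.dvd_or_dvd this).resolve_left fun h ↦ hpl (hpp.dvd_of_dvd_pow h)
  obtain ⟨h, hh, hDh⟩ := exists_isHomogeneous_of_dvd 1 hp ((he.pow 2).sub hD) hpe
  obtain rfl : D = e ^ 2 - p * h := by linear_combination -hDh
  obtain ⟨t, ht⟩ : p ∣ 2 * e * k + l * h := by
    have : p ∣ l * (2 * e * k + l * h) := by
      refine ⟨s - k ^ 2, mul_left_cancel₀ hp0 ?_⟩
      linear_combination hs
    exact (hpp.dvd_or_dvd this).resolve_left hpl
  have hze := hz.add (he.rename_isHomogeneous (f := Fin.succ))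
  have hze' := hz.sub (he.rename_isHomogeneous (f := Fin.succ))
  have hek : e * k ∈ Ideal.span {l, p} := by
    have : 2 * (e * k) ∈ Ideal.span {l, p} :=
      Ideal.mem_span_pair.2 ⟨-h, t, by linear_combination -ht⟩
    exact (Ideal.unit_mul_mem_iff_mem _ isUnit_two_mvPolynomial).1 this
  have hconst : ∀ f : MvPolynomial (Fin m) K, f.IsHomogeneous 1 → f ∈ Ideal.span {l, p} →
      ∃ a b : K, f = l * C a + p * C b := by
    intro f hf hfI
    obtain ⟨g, g', hg, hg', rfl⟩ := exists_isHomogeneous_of_mem_span_pair 0 hl hp hf hfI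
    obtain ⟨a, rfl⟩ := exists_eq_C_of_isHomogeneous_zero hg
    obtain ⟨b, rfl⟩ := exists_eq_C_of_isHomogeneous_zero hg'
    exact ⟨a, b, rfl⟩
  have hconst' : ∀ f : MvPolynomial (Fin m) K, f.IsHomogeneous 1 → p ∣ l * f →
      ∃ a : K, f = p * C a := by
    intro f hf hpf
    obtain ⟨g, hg, rfl⟩ := exists_isHomogeneous_of_dvd 0 hp hf
      ((hpp.dvd_or_dvd hpf).resolve_left hpl)
    obtain ⟨a, rfl⟩ := exists_eq_C_of_isHomogeneous_zero hg
    exact ⟨a, rfl⟩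
  rcases hI.mem_or_mem hek with hm | hm
  · left
    obtain ⟨a, b, hab⟩ := hconst e he hm
    obtain ⟨c, hc⟩ := hconst' (2 * C a * k + h)
      (by
        refine IsHomogeneous.add ?_ hh
        have := hk.C_mul (2 * a)
        rwa [C_mul, map_ofNat] at this)
      ⟨t - 2 * C b * k, by linear_combination ht - 2 * k * hab⟩
    obtain rfl : h = p * C c - 2 * C a * k := by linear_combination hc
    -- With e = a l + b p and h = c p - 2a k, adding 2a times the second form to the first gives (z
    -- + e)² - 2b (z + e) p + c p².
    refine ⟨X 0 + ι e, ι p, X 0 - ι e, ι (p * C c - 2 * C a * k), 1, 2 * a, 1, -2 * b, c, hze,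
      hp.rename_isHomogeneous, hze', hh.rename_isHomogeneous, ?_, by simp, ?_⟩
    · simp only [map_sub, map_mul, map_pow]; ring
    · have hab' := congrArg ι hab
      simp only [map_sub, map_mul, map_pow, map_add, rename_C, smul_eq_C_mul, C_1, map_ofNat,
        map_neg] at hab' ⊢
      linear_combination (-2 * X 0 - 2 * ι e) * hab'
  · right
    obtain ⟨a, b, rfl⟩ := hconst k hk hm
    obtain ⟨c, hc⟩ := hconst' (2 * C a * e + h)
      (by
        refine IsHomogeneous.add ?_ hh
        have := he.C_mul (2 * a)
        rwa [C_mul, map_ofNat] at this)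
      ⟨t - 2 * C b * e, by linear_combination ht⟩
    obtain rfl : h = p * C c - 2 * C a * e := by linear_combination hc
    have hap : (ι (a • p)).IsHomogeneous 1 := (isHomogeneous_smul hp a).rename_isHomogeneous
    -- With k = a l + b p and h = c p - 2a e, the forms are (z + e + a p)(z - e - a p) + (a² + c) p²
    -- and l (z + e + a p) + b p².
    refine ⟨X 0 + ι e + ι (a • p), ι p, X 0 - ι e - ι (a • p), ι l, a ^ 2 + c, b, hze.add hap,
      hp.rename_isHomogeneous, hze'.sub hap, hl.rename_isHomogeneous, ?_, ?_⟩
    · simp only [map_sub, map_mul, map_pow, map_add, rename_C, smul_eq_C_mul, map_ofNat]; ring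
    · simp only [map_mul, map_add, rename_C, smul_eq_C_mul]; ring

/-- The pencil of `z² - D` and `l z + q`, where `z` is the first variable. -/
theorem configuration_of_normalForm [IsAlgClosed K] [CharZero K]
    (hD : D.IsHomogeneous 2) (hl : l.IsHomogeneous 1) (hq : q.IsHomogeneous 2)
    (hirr : Irreducible (X 0 ^ 2 - ι D))
    (hrad : ¬ (Ideal.span {X 0 ^ 2 - ι D, ι l * X 0 + ι q}).IsRadical)
    (hsq : ∀ h : MvPolynomial (Fin (m + 1)) K, h.IsHomogeneous 1 → h ≠ 0 →
      h ^ 2 ∉ Submodule.span K {X 0 ^ 2 - ι D, ι l * X 0 + ι q}) :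
    HasBinaryMember (X 0 ^ 2 - ι D) (ι l * X 0 + ι q) ∨
      AreTangent (X 0 ^ 2 - ι D) (ι l * X 0 + ι q) := by
  rcases eq_or_ne l 0 with rfl | hl0
  · simp only [map_zero, zero_mul, zero_add] at hrad hsq ⊢
    exact Or.inr (areTangent_of_not_isRadical_of_linear_eq_zero hD hq hirr hrad hsq)
  by_cases hlq : l ∣ q
  · obtain ⟨e, he, rfl⟩ := exists_isHomogeneous_of_dvd 1 hl hq hlq
    exact configuration_of_not_isRadical_of_dvd hD hl hl0 he hirr hrad
  have hlp := prime_of_isHomogeneous_one hl hl0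
  have hr : (q ^ 2 - D * l ^ 2).IsHomogeneous 4 := (hq.pow 2).sub (hD.mul (hl.pow 2))
  have hr0 : q ^ 2 - D * l ^ 2 ≠ 0 := fun h ↦
    hlq (hlp.dvd_of_dvd_pow (n := 2) ⟨D * l, by linear_combination h⟩)
  have hns : ¬ Squarefree (q ^ 2 - D * l ^ 2) := fun h ↦
    hrad (isRadical_of_finSuccEquiv (isRadical_span_of_squarefree_norm hlp hlq h))
  obtain ⟨k, j, p, s, hk, hkj, hp, hs, hp0, hps⟩ := exists_sq_mul_of_not_squarefree hr hr0 hns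
  obtain ⟨rfl, rfl⟩ | ⟨rfl, rfl⟩ : (k = 1 ∧ j = 2) ∨ (k = 2 ∧ j = 0) := by omega
  · exact configuration_of_sq_dvd_norm hD hl hq hl0 hlq hp hp0 ⟨s, hps⟩
  · obtain ⟨c, rfl⟩ := exists_eq_C_of_isHomogeneous_zero hs
    obtain ⟨t, rfl⟩ := exists_pow_two_eq (c := c)
    obtain ⟨h, hh, hh0, hmem⟩ := exists_sq_mem_span_of_norm_eq_sq (D := D) hq hl hl0 hlq
      (isHomogeneous_smul hp t) (by rw [hps, smul_eq_C_mul, map_pow]; ring)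
    exact absurd hmem (hsq h hh hh0)

end NormalForm

/-! ### Linear changes of coordinates and completing the square -/

section LinearSubstitution

variable {K : Type*} [Field K] {m : ℕ}

theorem isHomogeneous_aeval_linear {σ τ : Type*} {f : σ → MvPolynomial τ K}
    (hf : ∀ i, (f i).IsHomogeneous 1) {p : MvPolynomial σ K} {k : ℕ} (hp : p.IsHomogeneous k) :
    (aeval f p).IsHomogeneous k := by
  simpa using hp.aeval f hf

/-- An automorphism given by mutually inverse linear substitutions. -/
theorem exists_algEquiv_of_linear {σ : Type*} {f g : σ → MvPolynomial σ K}
    (hf : ∀ i, (f i).IsHomogeneous 1) (hg : ∀ i, (g i).IsHomogeneous 1)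
    (hfg : ∀ i, aeval f (g i) = X i) (hgf : ∀ i, aeval g (f i) = X i) :
    ∃ φ : MvPolynomial σ K ≃ₐ[K] MvPolynomial σ K, (∀ p, φ p = aeval f p) ∧
      (∀ p k, p.IsHomogeneous k → (φ p).IsHomogeneous k) ∧
      ∀ p k, p.IsHomogeneous k → (φ.symm p).IsHomogeneous k := by
  refine ⟨AlgEquiv.ofAlgHom (aeval f) (aeval g) (algHom_ext fun i ↦ ?_) (algHom_ext fun i ↦ ?_),
    fun p ↦ rfl, fun p k hp ↦ isHomogeneous_aeval_linear hf hp,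
    fun p k hp ↦ isHomogeneous_aeval_linear hg hp⟩
  · rw [AlgHom.comp_apply, aeval_X, hfg]; rfl
  · rw [AlgHom.comp_apply, aeval_X, hgf]; rfl

theorem exists_quadratic_decomposition {F : MvPolynomial (Fin (m + 1)) K}
    (hF : F.IsHomogeneous 2) :
    ∃ (c : K) (l q : MvPolynomial (Fin m) K), l.IsHomogeneous 1 ∧ q.IsHomogeneous 2 ∧
      F = c • X 0 ^ 2 + rename Fin.succ l * X 0 + rename Fin.succ q := by
  have h2 := hF.finSuccEquiv_coeff_isHomogeneous 2 0 rfl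
  obtain ⟨c, hc⟩ := exists_eq_C_of_isHomogeneous_zero h2
  refine ⟨c, _, _, hF.finSuccEquiv_coeff_isHomogeneous 1 1 rfl,
    hF.finSuccEquiv_coeff_isHomogeneous 0 2 rfl, (finSuccEquiv K m).injective ?_⟩
  have hdeg : (finSuccEquiv K m F).natDegree < 3 := by
    rw [natDegree_finSuccEquiv]
    exact Nat.lt_succ_of_le ((degreeOf_le_totalDegree _ _).trans hF.totalDegree_le)
  have hC : finSuccEquiv K m (C c) = Polynomial.C (C c) := (finSuccEquiv K m).commutes c
  conv_lhs => rw [Polynomial.as_sum_range_C_mul_X_pow' _ hdeg]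
  simp only [Finset.sum_range_succ, Finset.sum_range_zero, hc, smul_eq_C_mul, map_add, map_mul,
    map_pow, finSuccEquiv_X_zero, finSuccEquiv_rename_succ, hC]
  ring

/-- The substitution moves (1, 0, …, 0) to a point where F does not vanish. For a quadratic form,
the value at (1, 0, …, 0) is the coefficient of the squared first variable. -/
theorem exists_algEquiv_coeff_ne_zero [Infinite K] {F : MvPolynomial (Fin (m + 1)) K}
    (hF0 : F ≠ 0) :
    ∃ φ : MvPolynomial (Fin (m + 1)) K ≃ₐ[K] MvPolynomial (Fin (m + 1)) K,
      (∀ p k, p.IsHomogeneous k → (φ p).IsHomogeneous k) ∧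
      (∀ p k, p.IsHomogeneous k → (φ.symm p).IsHomogeneous k) ∧
      eval (Fin.cons 1 0) (φ F) ≠ 0 := by
  -- The factor X 0 forces w 0 ≠ 0, which makes the substitution invertible.
  obtain ⟨w, hw⟩ : ∃ w, eval w (X 0 * F) ≠ 0 := by
    by_contra! h
    exact mul_ne_zero (X_ne_zero _) hF0 (MvPolynomial.funext fun w ↦ by rw [h w, map_zero])
  rw [map_mul, eval_X] at hw
  have hw0 := left_ne_zero_of_mul hw
  have hz : (X 0 : MvPolynomial (Fin (m + 1)) K).IsHomogeneous 1 := isHomogeneous_X _ _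
  have hC : (C (w 0) * C (w 0)⁻¹ : MvPolynomial (Fin (m + 1)) K) = 1 := by
    rw [← C_mul, mul_inv_cancel₀ hw0, C_1]
  obtain ⟨φ, hφ, h1, h2⟩ := exists_algEquiv_of_linear
    (f := Fin.cons (C (w 0) * X 0) fun i ↦ X i.succ + C (w i.succ) * X 0)
    (g := Fin.cons (C (w 0)⁻¹ * X 0) fun i ↦ X i.succ - C (w i.succ) * (C (w 0)⁻¹ * X 0))
    (Fin.cases (hz.C_mul _) fun i ↦ (isHomogeneous_X _ _).add (hz.C_mul _))
    (Fin.cases (hz.C_mul _) fun i ↦ (isHomogeneous_X _ _).sub ((hz.C_mul _).C_mul _))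
    (by
      refine Fin.cases ?_ fun i ↦ ?_
      · simp only [Fin.cons_zero, map_mul, algHom_C, aeval_X, algebraMap_eq]
        linear_combination X 0 * hC
      · simp only [Fin.cons_zero, Fin.cons_succ, map_sub, map_mul, algHom_C, aeval_X,
          algebraMap_eq]
        linear_combination -C (w i.succ) * X 0 * hC)
    (by
      refine Fin.cases ?_ fun i ↦ ?_
      · simp only [Fin.cons_zero, map_mul, algHom_C, aeval_X, algebraMap_eq]
        linear_combination X 0 * hC
      · simp only [Fin.cons_zero, Fin.cons_succ, map_add, map_mul, algHom_C, aeval_X,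
          algebraMap_eq]
        ring)
  refine ⟨φ, h1, h2, ?_⟩
  have : eval (Fin.cons 1 0) (φ F) = eval w F := by
    have key : (aeval (R := K) (Fin.cons 1 0 : Fin (m + 1) → K)).comp (φ : _ →ₐ[K] _) =
        aeval w := by
      refine algHom_ext (Fin.cases ?_ fun i ↦ ?_) <;> simp [hφ]
    have := DFunLike.congr_fun key F
    rwa [AlgHom.comp_apply, aeval_self_eq_eval, aeval_self_eq_eval] at this
  rw [this]
  exact right_ne_zero_of_mul hw

/-- After a linear change of coordinates, a nonzero quadratic form is `c (z² - D)`, where `z` is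
the first variable and `D` does not involve it. -/
theorem exists_algEquiv_normalForm [CharZero K] {F : MvPolynomial (Fin (m + 1)) K}
    (hF : F.IsHomogeneous 2) (hF0 : F ≠ 0) :
    ∃ φ : MvPolynomial (Fin (m + 1)) K ≃ₐ[K] MvPolynomial (Fin (m + 1)) K,
      (∀ p k, p.IsHomogeneous k → (φ p).IsHomogeneous k) ∧
      (∀ p k, p.IsHomogeneous k → (φ.symm p).IsHomogeneous k) ∧
      ∃ (c : K) (D : MvPolynomial (Fin m) K), c ≠ 0 ∧ D.IsHomogeneous 2 ∧
        φ F = c • (X 0 ^ 2 - rename Fin.succ D) := by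
  obtain ⟨φ, h1, h2, hev⟩ := exists_algEquiv_coeff_ne_zero hF0
  obtain ⟨c, l, q, hl, hq, hφF⟩ := exists_quadratic_decomposition (h1 F 2 hF)
  have hcomp : ((Fin.cons 1 0 : Fin (m + 1) → K) ∘ Fin.succ) = 0 := by
    funext i; simp
  have hc : c ≠ 0 := by
    have hev0 : ∀ {f : MvPolynomial (Fin m) K} {k : ℕ}, f.IsHomogeneous k → k ≠ 0 →
        eval 0 f = 0 := by
      intro f k hf hk
      have h0 : coeff 0 f = 0 := hf.coeff_eq_zero (by simpa using hk.symm)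
      rw [← h0, ← constantCoeff_eq]
      exact DFunLike.congr_fun (eval_zero (R := K)) f
    rw [hφF] at hev
    simp only [map_add, map_mul, map_pow, smul_eval, eval_rename, hcomp, hev0 hl one_ne_zero,
      hev0 hq two_ne_zero] at hev
    simpa using hev
  have hz : (X 0 : MvPolynomial (Fin (m + 1)) K).IsHomogeneous 1 := isHomogeneous_X _ _
  -- Completing the square: z ↦ z - d l removes the term l z.
  set d : K := (2 * c)⁻¹ with hd
  have hιl := (hl.C_mul d).rename_isHomogeneous (f := Fin.succ)
  have hfix : ∀ g : MvPolynomial (Fin (m + 1)) K, ∀ p : MvPolynomial (Fin m) K,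
      aeval (Fin.cons g fun i ↦ X i.succ : Fin (m + 1) → MvPolynomial (Fin (m + 1)) K)
        (rename Fin.succ p) = rename Fin.succ p := by
    intro g p
    have : (Fin.cons g fun i ↦ X i.succ : Fin (m + 1) → MvPolynomial (Fin (m + 1)) K) ∘ Fin.succ =
        X ∘ Fin.succ := by funext i; simp
    rw [aeval_rename, this]
    exact DFunLike.congr_fun (algHom_ext (f := aeval (X ∘ Fin.succ)) (g := rename Fin.succ)
      (by simp)) p
  have hhom : ∀ g : MvPolynomial (Fin (m + 1)) K, g.IsHomogeneous 1 → ∀ i,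
      ((Fin.cons g fun i ↦ X i.succ : Fin (m + 1) → MvPolynomial (Fin (m + 1)) K)
        i).IsHomogeneous 1 := fun g hg ↦ Fin.cases hg fun i ↦ isHomogeneous_X _ _
  obtain ⟨ψ, hψ, h3, h4⟩ := exists_algEquiv_of_linear
    (f := Fin.cons (X 0 - rename Fin.succ (C d * l)) fun i ↦ X i.succ)
    (g := Fin.cons (X 0 + rename Fin.succ (C d * l)) fun i ↦ X i.succ)
    (hhom _ (hz.sub hιl)) (hhom _ (hz.add hιl))
    (by
      refine Fin.cases ?_ fun i ↦ ?_
      · simp only [Fin.cons_zero, map_add, aeval_X, hfix]; ring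
      · simp only [Fin.cons_succ, aeval_X])
    (by
      refine Fin.cases ?_ fun i ↦ ?_
      · simp only [Fin.cons_zero, map_sub, aeval_X, hfix]; ring
      · simp only [Fin.cons_succ, aeval_X])
  refine ⟨φ.trans ψ, fun p k hp ↦ h3 _ _ (h1 _ _ hp), fun p k hp ↦ h2 _ _ (h4 _ _ hp), c,
    C (d ^ 2) * l ^ 2 - C c⁻¹ * q, hc, (((hl.pow 2).C_mul _)).sub (hq.C_mul _), ?_⟩
  rw [AlgEquiv.trans_apply, hφF, hψ]
  have hcd : (2 * C c * C d : MvPolynomial (Fin (m + 1)) K) = 1 := by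
    rw [hd, ← map_ofNat (C : K →+* _), ← C_mul, ← C_mul,
      mul_inv_cancel₀ (mul_ne_zero two_ne_zero hc), C_1]
  have hcc : (C c * C c⁻¹ : MvPolynomial (Fin (m + 1)) K) = 1 := by
    rw [← C_mul, mul_inv_cancel₀ hc, C_1]
  simp only [smul_eq_C_mul, map_add, map_mul, map_pow, map_sub, algHom_C, algebraMap_eq, aeval_X,
    Fin.cons_zero, hfix]
  linear_combination (-rename Fin.succ l * X 0 + C d * rename Fin.succ l ^ 2) * hcd -
    rename Fin.succ q * hcc

end LinearSubstitution

/-! ### Invariance under coordinate changes and change of pencil generators -/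

section Transport

variable {K σ : Type*} [Field K] {P₁ P₂ : MvPolynomial σ K}
  {ψ : MvPolynomial σ K ≃ₐ[K] MvPolynomial σ K}

theorem HasBinaryMember.transport (h : HasBinaryMember P₁ P₂)
    (hψ : ∀ p k, p.IsHomogeneous k → (ψ p).IsHomogeneous k) {c : K} (hc : c ≠ 0) (t : K) :
    HasBinaryMember (c • ψ P₁) (ψ P₂ + t • ψ P₁) := by
  obtain ⟨x, y, a, b, r, s, α, β, γ, hx, hy, ha, hb, h1, hrs, h2⟩ := h
  refine ⟨ψ x, ψ y, c • ψ a, c • ψ b, (r - s * t) * c⁻¹, s, α, β, γ, hψ _ _ hx, hψ _ _ hy,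
    isHomogeneous_smul (hψ _ _ ha) _, isHomogeneous_smul (hψ _ _ hb) _, ?_, ?_, ?_⟩
  · rw [h1]; simp only [map_add, map_mul, smul_eq_C_mul]; ring
  · by_contra! h
    obtain ⟨h, rfl⟩ := h
    simp [hc] at h
    simp [h] at hrs
  · have := congrArg ψ h2
    simp only [map_add, map_smul, map_mul, map_pow] at this
    rw [← this, smul_smul, inv_mul_cancel_right₀ hc]
    module

theorem AreTangent.transport (h : AreTangent P₁ P₂)
    (hψ : ∀ p k, p.IsHomogeneous k → (ψ p).IsHomogeneous k) (c t : K) :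
    AreTangent (c • ψ P₁) (ψ P₂ + t • ψ P₁) := by
  obtain ⟨x, y, a, b, α, β, hx, hy, ha, hb, h1, h2⟩ := h
  refine ⟨ψ x, ψ y, c • ψ a, ψ b + t • ψ a, c * α, β + t * α, hψ _ _ hx, hψ _ _ hy,
    isHomogeneous_smul (hψ _ _ ha) _, (hψ _ _ hb).add (isHomogeneous_smul (hψ _ _ ha) _), ?_, ?_⟩
  · rw [h1]
    simp only [map_add, map_mul, map_smul, map_pow]
    simp only [smul_eq_C_mul, C_mul]
    ring
  · rw [h1, h2]
    simp only [map_add, map_mul, map_smul, map_pow]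
    simp only [smul_eq_C_mul, C_mul, C_add]
    ring

theorem ideal_span_pencil_le {c : K} (t : K) :
    Ideal.span {c • P₁, P₂ + t • P₁} ≤ Ideal.span {P₁, P₂} := by
  have h1 : P₁ ∈ Ideal.span {P₁, P₂} := Ideal.subset_span (by simp)
  have h2 : P₂ ∈ Ideal.span {P₁, P₂} := Ideal.subset_span (by simp)
  rw [Ideal.span_le, Set.insert_subset_iff, Set.singleton_subset_iff]
  simp only [smul_eq_C_mul]
  exact ⟨Ideal.mul_mem_left _ _ h1, Ideal.add_mem _ h2 (Ideal.mul_mem_left _ _ h1)⟩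

theorem ideal_span_pencil {c : K} (hc : c ≠ 0) (t : K) :
    Ideal.span {c • P₁, P₂ + t • P₁} = Ideal.span {P₁, P₂} := by
  refine le_antisymm (ideal_span_pencil_le t) ?_
  have := ideal_span_pencil_le (P₁ := c • P₁) (P₂ := P₂ + t • P₁) (c := c⁻¹) (-(t * c⁻¹))
  rwa [smul_smul, smul_smul, inv_mul_cancel₀ hc, one_smul, neg_mul, inv_mul_cancel_right₀ hc,
    neg_smul, add_neg_cancel_right] at this

theorem submodule_span_pencil_le {c : K} (t : K) :
    Submodule.span K {c • P₁, P₂ + t • P₁} ≤ Submodule.span K {P₁, P₂} := by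
  have h1 : P₁ ∈ Submodule.span K {P₁, P₂} := Submodule.subset_span (by simp)
  have h2 : P₂ ∈ Submodule.span K {P₁, P₂} := Submodule.subset_span (by simp)
  rw [Submodule.span_le, Set.insert_subset_iff, Set.singleton_subset_iff]
  exact ⟨Submodule.smul_mem _ _ h1, Submodule.add_mem _ h2 (Submodule.smul_mem _ _ h1)⟩

theorem submodule_span_pencil {c : K} (hc : c ≠ 0) (t : K) :
    Submodule.span K {c • P₁, P₂ + t • P₁} = Submodule.span K {P₁, P₂} := by
  refine le_antisymm (submodule_span_pencil_le t) ?_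
  have := submodule_span_pencil_le (P₁ := c • P₁) (P₂ := P₂ + t • P₁) (c := c⁻¹) (-(t * c⁻¹))
  rwa [smul_smul, smul_smul, inv_mul_cancel₀ hc, one_smul, neg_mul, inv_mul_cancel_right₀ hc,
    neg_smul, add_neg_cancel_right] at this

end Transport

/-! ### Classification of nonradical pencils -/

section Classification

variable {K : Type*} [Field K] {n : ℕ}

/-- A pencil of quadrics that contains no square of a linear form and generates an ideal that is
not radical has a binary member or consists of forms tangent along a codimension two subspace. -/
theorem configuration_of_not_isRadical [IsAlgClosed K] [CharZero K]
    {Q₁ Q₂ : MvPolynomial (Fin n) K} (hQ₁ : Q₁.IsHomogeneous 2) (hQ₂ : Q₂.IsHomogeneous 2) (hirr : Irreducible Q₁)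
    (hrad : ¬ (Ideal.span {Q₁, Q₂}).IsRadical)
    (hsq : ∀ l : MvPolynomial (Fin n) K, l.IsHomogeneous 1 → l ≠ 0 →
      l ^ 2 ∉ Submodule.span K {Q₁, Q₂}) :
    HasBinaryMember Q₁ Q₂ ∨ AreTangent Q₁ Q₂ := by
  obtain _ | m := n
  · exact absurd (hQ₁.inj_right (isHomogeneous_of_isEmpty _ _ Q₁) hirr.ne_zero) two_ne_zero
  obtain ⟨φ, h1, h2, c, D, hc, hD, hφ₁⟩ := exists_algEquiv_normalForm hQ₁ hirr.ne_zero
  obtain ⟨t, l, q, hl, hq, hφ₂⟩ := exists_quadratic_decomposition (h1 _ _ hQ₂)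
  set P₁ : MvPolynomial (Fin (m + 1)) K := X 0 ^ 2 - rename Fin.succ D with hP₁
  -- The image of Q₂ minus t P₁, which cancels the term t z².
  set P₂ : MvPolynomial (Fin (m + 1)) K :=
    rename Fin.succ l * X 0 + rename Fin.succ (q + t • D) with hP₂
  have e1 : Q₁ = c • φ.symm P₁ := by
    rw [← map_smul, ← hφ₁, AlgEquiv.symm_apply_apply]
  have e2 : Q₂ = φ.symm P₂ + t • φ.symm P₁ := by
    rw [← map_smul, ← map_add, AlgEquiv.eq_symm_apply, hφ₂, hP₁, hP₂]
    simp only [map_add, map_smul, smul_sub]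
    abel
  have hirr' : Irreducible P₁ := by
    have : Irreducible (C c * P₁) := by
      rw [← smul_eq_C_mul, ← hφ₁]
      exact (MulEquiv.irreducible_iff φ.toMulEquiv).2 hirr
    exact (irreducible_isUnit_mul ((isUnit_iff_ne_zero.2 hc).map C)).1 this
  have hrad' : ¬ (Ideal.span {P₁, P₂}).IsRadical := by
    intro h
    refine hrad ?_
    rw [e1, e2, ideal_span_pencil hc]
    exact isRadical_span_pair_of_map φ.toRingEquiv (by simpa using h)
  have hsq' : ∀ l : MvPolynomial (Fin (m + 1)) K, l.IsHomogeneous 1 → l ≠ 0 →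
      l ^ 2 ∉ Submodule.span K {P₁, P₂} := by
    intro l hl hl0 hmem
    refine hsq (φ.symm l) (h2 _ _ hl) (by simpa using hl0) ?_
    rw [e1, e2, submodule_span_pencil hc]
    obtain ⟨r, s, hrs⟩ := Submodule.mem_span_pair.1 hmem
    exact Submodule.mem_span_pair.2 ⟨r, s, by
      rw [← map_pow, ← hrs, map_add φ.symm (r • P₁), map_smul, map_smul]⟩
  rw [e1, e2]
  exact (configuration_of_normalForm hD hl (hq.add (isHomogeneous_smul hD t)) hirr' hrad'
    hsq').imp (fun h ↦ h.transport h2 hc t) fun h ↦ h.transport h2 c t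

/-- If x = 0 or y is a multiple of x, then Q is a product of two linear forms. -/
theorem linearIndependent_pair_of_tangent {Q a x y : MvPolynomial (Fin n) K} {α : K}
    (hQ : Irreducible Q) (hx : x.IsHomogeneous 1) (hy : y.IsHomogeneous 1)
    (ha : a.IsHomogeneous 1) (h : Q = a * x + α • y ^ 2) : LinearIndependent K ![x, y] := by
  have hx0 : x ≠ 0 := by
    rintro rfl
    refine not_irreducible_mul (isHomogeneous_smul hy α) hy one_ne_zero one_ne_zero ?_
    convert! hQ using 1
    rw [h]; simp only [smul_eq_C_mul]; ring
  rw [LinearIndependent.pair_iff' hx0]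
  rintro t rfl
  refine not_irreducible_mul (ha.add (isHomogeneous_smul hx (α * t ^ 2))) hx one_ne_zero
    one_ne_zero ?_
  convert! hQ using 1
  rw [h]
  simp only [smul_eq_C_mul, C_mul, C_pow]; ring

theorem ne_zero_of_tangent {Q a x y : MvPolynomial (Fin n) K} {α : K}
    (hQ : Irreducible Q) (hx : x.IsHomogeneous 1) (ha : a.IsHomogeneous 1)
    (h : Q = a * x + α • y ^ 2) : α ≠ 0 := by
  rintro rfl
  refine not_irreducible_mul ha hx one_ne_zero one_ne_zero ?_
  simpa [h] using hQ

/-- Multiplying a relation g₀ a + g₁ b + g₂ x + g₃ y = 0 by x makes g₀ c₁⁻¹ Q₁ + g₁ c₂⁻¹ Q₂ a binary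
form in x and y. As Lin separates Q₁ and Q₂, this forces g₀ = g₁ = 0. -/
theorem linearIndependent_of_tangent [IsAlgClosed K] {Q₁ Q₂ a b x y : MvPolynomial (Fin n) K} {c₁ c₂ : K}
    (hirr₁ : Irreducible Q₁) (hirr₂ : Irreducible Q₂)
    (hlin : QuadraticForms.Lin Q₁ ≠ QuadraticForms.Lin Q₂) (hx : x.IsHomogeneous 1)
    (hy : y.IsHomogeneous 1) (ha : a.IsHomogeneous 1)
    (hli : LinearIndependent K ![x, y]) (hc₁ : c₁ ≠ 0) (hc₂ : c₂ ≠ 0)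
    (h₁ : Q₁ = c₁ • (a * x + y ^ 2)) (h₂ : Q₂ = c₂ • (b * x + y ^ 2)) :
    LinearIndependent K ![a, b, x, y] := by
  rw [Fintype.linearIndependent_iff]
  intro g hg
  simp only [Fin.sum_univ_four, Matrix.cons_val] at hg
  by_cases h01 : g 0 ≠ 0 ∨ g 1 ≠ 0
  · refine absurd (lin_eq_lin_of_binary_member (a := c₁ • a) (b := c₁ • y) (x := x) (y := y)
      (r := g 0 * c₁⁻¹) (s := g 1 * c₂⁻¹) (α := -g 2) (β := -g 3) (γ := g 0 + g 1) hirr₁ hirr₂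
      (isHomogeneous_smul ha _) (isHomogeneous_smul hy _) hx hy ?_ ?_ ?_) hlin
    · rw [h₁]; simp only [smul_eq_C_mul]; ring
    · simpa [hc₁, hc₂] using h01
    · rw [h₁, h₂, smul_smul, smul_smul, inv_mul_cancel_right₀ hc₁, inv_mul_cancel_right₀ hc₂]
      simp only [smul_eq_C_mul, C_neg, C_add] at hg ⊢
      linear_combination x * hg
  · push Not at h01
    obtain ⟨h0, h1⟩ := h01
    rw [h0, h1, zero_smul, zero_smul, zero_add, zero_add] at hg
    obtain ⟨h2, h3⟩ := LinearIndependent.pair_iff.1 hli _ _ hg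
    simp [Fin.forall_fin_succ, h0, h1, h2, h3]

end Classification

end QuadricPencil

/-! ### The theorem: tangent form and primary component -/

open QuadricPencil MvPolynomial in
theorem proposition3p10 {K : Type*} [Field K] [IsAlgClosed K] [CharZero K] {n : ℕ}
    (Q₁ Q₂ : MvPolynomial (Fin n) K)
    (hQ₁ : Q₁.IsHomogeneous 2) (hQ₂ : Q₂.IsHomogeneous 2)
    (hirr₁ : Irreducible Q₁) (hirr₂ : Irreducible Q₂)
    (hlin : QuadraticForms.Lin Q₁ ≠ QuadraticForms.Lin Q₂)
    (hrad : ¬ (Ideal.span {Q₁, Q₂}).IsRadical)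
    (hsq : ∀ l : MvPolynomial (Fin n) K, l.IsHomogeneous 1 → l ≠ 0 →
      l ^ 2 ∉ Submodule.span K {Q₁, Q₂}) :
    ∃ x y : MvPolynomial (Fin n) K,
      x.IsHomogeneous 1 ∧ y.IsHomogeneous 1 ∧ LinearIndependent K ![x, y] ∧
      Ideal.span {x, y} ∈ (Ideal.span {Q₁, Q₂}).minimalPrimes ∧
      QuadraticForms.IsPrimaryComponent (Ideal.span {Q₁, Q₂}) (Ideal.span {x, y})
        (Ideal.span {x, y ^ 2}) ∧
      ∃ (a b : MvPolynomial (Fin n) K) (c₁ c₂ : K),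
        a.IsHomogeneous 1 ∧ b.IsHomogeneous 1 ∧ LinearIndependent K ![a, b, x, y] ∧
        c₁ ≠ 0 ∧ c₂ ≠ 0 ∧
        Q₁ = c₁ • (a * x + y ^ 2) ∧ Q₂ = c₂ • (b * x + y ^ 2) := by
  rcases configuration_of_not_isRadical hQ₁ hQ₂ hirr₁ hrad hsq with h | h
  · obtain ⟨x, y, a, b, r, s, α, β, γ, hx, hy, ha, hb, h1, hrs, h2⟩ := h
    exact absurd (lin_eq_lin_of_binary_member hirr₁ hirr₂ ha hb hx hy h1 hrs h2) hlin
  obtain ⟨x, y, a, b, c₁, c₂, hx, hy, ha, hb, h₁, h₂⟩ := h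
  have hc₁ := ne_zero_of_tangent hirr₁ hx ha h₁
  have hc₂ := ne_zero_of_tangent hirr₂ hx hb h₂
  have hli := linearIndependent_pair_of_tangent hirr₁ hx hy ha h₁
  obtain ⟨a, rfl⟩ : ∃ a', a = c₁ • a' :=
    ⟨c₁⁻¹ • a, by rw [smul_smul, mul_inv_cancel₀ hc₁, one_smul]⟩
  obtain ⟨b, rfl⟩ : ∃ b', b = c₂ • b' :=
    ⟨c₂⁻¹ • b, by rw [smul_smul, mul_inv_cancel₀ hc₂, one_smul]⟩
  replace ha : a.IsHomogeneous 1 := by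
    simpa [smul_smul, hc₁] using isHomogeneous_smul ha c₁⁻¹
  replace hb : b.IsHomogeneous 1 := by
    simpa [smul_smul, hc₂] using isHomogeneous_smul hb c₂⁻¹
  rw [smul_mul_assoc, ← smul_add] at h₁ h₂
  have hli4 := linearIndependent_of_tangent hirr₁ hirr₂ hlin hx hy ha hli hc₁ hc₂ h₁ h₂
  -- By degrees, membership would make a - b a scalar combination of x and y.
  have hdiff : a - b ∉ Ideal.span {x, y} := by
    intro hm
    obtain ⟨g, k, hg, hk, hgk⟩ := exists_isHomogeneous_of_mem_span_pair 0 hx hy (ha.sub hb) hm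
    obtain ⟨u, rfl⟩ := exists_eq_C_of_isHomogeneous_zero hg
    obtain ⟨v, rfl⟩ := exists_eq_C_of_isHomogeneous_zero hk
    have := Fintype.linearIndependent_iff.1 hli4 ![1, -1, -u, -v] (by
      simp only [Fin.sum_univ_four, Matrix.cons_val, smul_eq_C_mul, C_neg, C_1]
      linear_combination hgk) 0
    simp at this
  have hmem₁ : ∀ J : Ideal (MvPolynomial (Fin n) K), Ideal.span {Q₁, Q₂} ≤ J →
      a * x + y ^ 2 ∈ J := fun J hJ ↦ by
    have := J.mul_mem_left (C c₁⁻¹) (hJ (Ideal.subset_span (Set.mem_insert _ _)))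
    rwa [← smul_eq_C_mul, h₁, smul_smul, inv_mul_cancel₀ hc₁, one_smul] at this
  have hmem₂ : ∀ J : Ideal (MvPolynomial (Fin n) K), Ideal.span {Q₁, Q₂} ≤ J →
      b * x + y ^ 2 ∈ J := fun J hJ ↦ by
    have := J.mul_mem_left (C c₂⁻¹) (hJ (Ideal.subset_span (Set.mem_insert_of_mem _ rfl)))
    rwa [← smul_eq_C_mul, h₂, smul_smul, inv_mul_cancel₀ hc₂, one_smul] at this
  have hxab : ∀ J : Ideal (MvPolynomial (Fin n) K), Ideal.span {Q₁, Q₂} ≤ J →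
      x * (a - b) ∈ J := fun J hJ ↦ by
    convert! J.sub_mem (hmem₁ J hJ) (hmem₂ J hJ) using 1
    ring
  have hy2 : ∀ J : Ideal (MvPolynomial (Fin n) K), Ideal.span {Q₁, Q₂} ≤ J → x ∈ J →
      y ^ 2 ∈ J := fun J hJ hxJ ↦ (J.add_mem_iff_right (J.mul_mem_left a hxJ)).1 (hmem₁ J hJ)
  have hIle : Ideal.span {Q₁, Q₂} ≤ Ideal.span {x, y ^ 2} := by
    rw [Ideal.span_le, Set.insert_subset_iff, Set.singleton_subset_iff]
    refine ⟨Ideal.mem_span_pair.2 ⟨c₁ • a, C c₁, ?_⟩, Ideal.mem_span_pair.2 ⟨c₂ • b, C c₂, ?_⟩⟩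
    · rw [h₁, smul_eq_C_mul, smul_eq_C_mul]; ring
    · rw [h₂, smul_eq_C_mul, smul_eq_C_mul]; ring
  have hrad' := radical_span_pair_sq hx hy hli
  have hmin : Ideal.span {x, y} ∈ (Ideal.span {Q₁, Q₂}).minimalPrimes := by
    refine ⟨⟨isPrime_span_pair hx hy hli, hIle.trans (hrad' ▸ Ideal.le_radical)⟩, ?_⟩
    rintro J ⟨hJ, hIJ⟩ hJle
    have hxJ : x ∈ J := (hJ.mem_or_mem (hxab J hIJ)).resolve_right fun h ↦ hdiff (hJle h)
    rw [Ideal.span_le, Set.insert_subset_iff, Set.singleton_subset_iff]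
    exact ⟨hxJ, hJ.mem_of_pow_mem 2 (hy2 J hIJ hxJ)⟩
  refine ⟨x, y, hx, hy, hli, hmin, isPrimaryComponent_of_forall_le hmin hIle
    (isPrimary_span_pair_sq hx hy hli) hrad' fun J hJ hJrad hIJ ↦ ?_,
    a, b, c₁, c₂, ha, hb, hli4, hc₁, hc₂, h₁, h₂⟩
  -- x (a - b) lies in J and a - b lies outside its radical.
  have hxJ : x ∈ J := ((Ideal.isPrimary_iff.1 hJ).2 (hxab J hIJ)).resolve_right (hJrad ▸ hdiff)
  rw [Ideal.span_le, Set.insert_subset_iff, Set.singleton_subset_iff]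
  exact ⟨hxJ, hy2 J hIJ hxJ⟩
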